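/- Let $A\in\mathbb{R}^{n\times d}$, let $\mathcal K\subseteq\mathbb{R}^d$ be any set, let $x^\star\in\mathcal K$, and let $\mathcal C$ be the smallest closed cone containing $\mathcal K-x^\star$. Write $\mathcal B^d$ for the closed Euclidean unit ball of $\mathbb{R}^d$ and $\mathbb S^{n-1}$ for the unit sphere of $\mathbb{R}^n$. Let $L$ be the largest singular value of $A^TA$, and assume that there is a largest positive constant $\mu_c$ with $\|Az\|_2^2\ge\mu_c\|z\|_2^2$ for all $z\in\mathcal C$. Let $\mathcal W=\mathbb E\sup_{v\in A\mathcal C\cap\mathbb S^{n-1}}v^Tg$ with $g\sim\mathcal N(0,I_n)$, the Gaussian width of $A\mathcal C\cap\mathbb S^{n-1}$. For an integer $m\ge1$ let $b_m=\sqrt2\,\Gamma(\frac{m+1}{2})/\Gamma(\frac m2)$, and let $S\in\mathbb{R}^{m\times n}$ be a random matrix with i.i.d. $\mathcal N(0,1)$ entries. For $\theta\ge0$ put $$\eta=\frac{1}{L(b_m+\sqrt d+\theta)^2},\qquad \alpha(\eta,SA)=\sup_{u,v\in\mathcal C\cap\mathcal B^d}v^T(I-\eta A^TS^TSA)u .$$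 (i) If $\mathcal W+\theta\le b_m$, then with probability at least $1-2e^{-\theta^2/2}$ $$\alpha(\eta,SA)\le 1-\frac{\mu_c}{L}\,\frac{(b_m-\mathcal W-\theta)^2}{(b_m+\sqrt d+\theta)^2}.$$ (ii) A sketch size $m\gtrsim\mathcal W^2$ is enough for $\alpha<1$: there is an absolute constant $c>0$, independent of all the data above, such that whenever $m\ge c\,(\mathcal W+\theta)^2$, one has $\alpha(\eta,SA)<1$ with probability at least $1-2e^{-\theta^2/2}$. -/

import Mathlib

open MeasureTheory ProbabilityTheory

noncomputable section

namespace SketchedPGD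

/-- `ℝᵏ` with the Euclidean norm. -/
abbrev Vec (k : ℕ) : Type := EuclideanSpace ℝ (Fin k)

/-- A (not necessarily convex) cone: a set closed under multiplication by nonnegative scalars. -/
def IsCone {d : ℕ} (C : Set (Vec d)) : Prop :=
  ∀ t : ℝ, 0 ≤ t → ∀ z ∈ C, t • z ∈ C

/-- The smallest closed cone containing `K - x`, as the intersection of all closed cones that
contain `K - x`. -/
def descentCone {d : ℕ} (K : Set (Vec d)) (x : Vec d) : Set (Vec d) :=
  ⋂₀ {C | IsClosed C ∧ IsCone C ∧ ∀ k ∈ K, k - x ∈ C}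

/-- The contraction factor `α(η, B) = sup_{u, v ∈ C ∩ 𝔹} vᵀ (I - η Bᵀ B) u`, where `𝔹` is the closed
Euclidean unit ball; it is used with `B = S A`. -/
def contractionFactor {m d : ℕ} (C : Set (Vec d)) (η : ℝ) (B : Matrix (Fin m) (Fin d) ℝ) : ℝ :=
  sSup {r | ∃ u ∈ C ∩ Metric.closedBall 0 1, ∃ v ∈ C ∩ Metric.closedBall 0 1,
    r = inner ℝ v (Matrix.toEuclideanLin (1 - η • (B.transpose * B)) u)}

/-- `μ` is the cone-restricted strong convexity constant of `A` on `C`: the largest positive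
constant with `‖A z‖² ≥ μ ‖z‖²` for all `z ∈ C`. -/
def IsConeStrongConvexityConst {n d : ℕ} (A : Matrix (Fin n) (Fin d) ℝ) (C : Set (Vec d))
    (μ : ℝ) : Prop :=
  IsGreatest {c : ℝ | 0 < c ∧ ∀ z ∈ C, c * ‖z‖ ^ 2 ≤ ‖Matrix.toEuclideanLin A z‖ ^ 2} μ

/-- The Lipschitz constant `L`: the largest singular value of `Aᵀ A`. -/
def lipschitzConst {n d : ℕ} (A : Matrix (Fin n) (Fin d) ℝ) : ℝ :=
  (Matrix.toEuclideanLin (A.transpose * A)).singularValues 0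

/-- The Gaussian width `𝔼 sup_{v ∈ T} vᵀ g`, with `g ∼ N(0, Iₙ)`. -/
def gaussianWidth {n : ℕ} (T : Set (Vec n)) : ℝ :=
  ∫ g, sSup ((fun v : Vec n => inner ℝ v g) '' T) ∂(stdGaussian (Vec n))

/-- The Gaussian width of `A C ∩ 𝕊ⁿ⁻¹`. -/
def coneWidth {n d : ℕ} (A : Matrix (Fin n) (Fin d) ℝ) (C : Set (Vec d)) : ℝ :=
  gaussianWidth ((Matrix.toEuclideanLin A '' C) ∩ Metric.sphere 0 1)

/-- `b_m = √2 Γ((m+1)/2) / Γ(m/2)`. -/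
def gaussianNormMean (m : ℕ) : ℝ :=
  √2 * Real.Gamma (((m : ℝ) + 1) / 2) / Real.Gamma ((m : ℝ) / 2)

/-- The entries of the random matrix `S` are i.i.d. standard normal. -/
def IsGaussianSketch {Ω : Type*} [MeasurableSpace Ω] (P : Measure Ω) {m n : ℕ}
    (S : Ω → Matrix (Fin m) (Fin n) ℝ) : Prop :=
  (∀ i j, HasLaw (fun ω => S ω i j) (gaussianReal 0 1) P) ∧
    iIndepFun (fun (p : Fin m × Fin n) (ω : Ω) => S ω p.1 p.2) P

/-- The conservative step size `η = 1 / (L (b_m + √d + θ)²)`. -/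
def conservativeStep {n d : ℕ} (A : Matrix (Fin n) (Fin d) ℝ) (m : ℕ) (θ : ℝ) : ℝ :=
  1 / (lipschitzConst A * (gaussianNormMean m + √(d : ℝ) + θ) ^ 2)

end SketchedPGD

end

/-! The deterministic core is a polarization argument. Put B = SA and q(u) = ‖u‖² - η‖Bu‖². If S
stretches unit vectors of range A by at most γ and those of A C by at least β ≥ 0, then with η =
1/(Lγ²) the form q is nonnegative on all of ℝᵈ and q(u) ≤ (1 - ημβ²)‖u‖² on C. Nonnegativity of q at
u - v bounds the associated bilinear form at (v, u) by (q(u) + q(v))/2, so C need not be convex.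
This is `contractionFactor_le`.

It remains to take β = b_m - W - θ and γ = b_m + √d + θ, each failing with probability at most
exp(-θ²/2). Two Gaussian facts suffice, and both follow from one interpolation theorem,
`integral_gaussianPi_le_of_hessian_le`. Along the path cos θ · X + sin θ · Y, Stein's identity turns
the derivative of E Φ into a difference of Hessians summed along the two noise families. A pointwise
Hessian inequality therefore gives an inequality of expectations.

Gordon's inequality (`gordon`): compare ‖Sv‖ plus a common scalar noise with ‖g‖ + ⟨v, h⟩, through a
log-sum-exp over v and a smoothed norm. The norm enters only through its gradients p, of length at
most 1, and the Hessian inequality reduces to (1 - ⟨p, p'⟩)(1 - ⟨v, v'⟩) ≥ 0. The argument is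
insensitive to the sign of the log-sum-exp parameter, so ε = -1 and ε = 1 give the lower and the
upper bound at once.

Concentration (`stdGaussian_real_ge_le_exp`): comparing (X, X) with an independent pair (X, Y) for
exp(s(M(x) + M(y))) gives E exp(2sM) ≤ exp(s²)(E exp(sM))². Iterated halving of s produces the sharp
factor exp(s²/2).

The smallest and largest values of ‖Sv‖ are 1-Lipschitz in S for the Frobenius norm, so the two
facts combine in `stdGaussian_real_sketch_le_exp`. The sphere of range A has width at most √d, and
b_m is the mean norm of a Gaussian vector in ℝᵐ. Part (ii) follows from b_m² ≥ m/2. Functions of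
exponential growth supply all the integrability. -/

noncomputable section

namespace SketchedPGD

/-! ### Functions of exponential growth -/

/-- A real function growing at most exponentially in the norm. -/
def ExpGrowth {E : Type*} [NormedAddCommGroup E] (f : E → ℝ) : Prop :=
  ∃ C : ℝ, 0 ≤ C ∧ ∀ x, |f x| ≤ C * Real.exp (C * ‖x‖)

namespace ExpGrowth

variable {E F : Type*} [NormedAddCommGroup E] [NormedAddCommGroup F] {f g : E → ℝ}

lemma of_le (hg : ExpGrowth g) (h : ∀ x, |f x| ≤ |g x|) : ExpGrowth f := by
  obtain ⟨C, hC, hg⟩ := hg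
  exact ⟨C, hC, fun x => (h x).trans (hg x)⟩

lemma of_exp_le {a b : ℝ} (h : ∀ x, |f x| ≤ a * Real.exp (b * ‖x‖)) : ExpGrowth f := by
  refine ⟨max 0 (max a b), le_max_left _ _, fun x => (h x).trans ?_⟩
  have ha : a ≤ max 0 (max a b) := (le_max_left _ _).trans (le_max_right _ _)
  have hb : b ≤ max 0 (max a b) := (le_max_right _ _).trans (le_max_right _ _)
  gcongr

lemma of_bounded {a : ℝ} (h : ∀ x, |f x| ≤ a) : ExpGrowth f :=
  of_exp_le (a := a) (b := 0) (by simpa using h)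

lemma const (a : ℝ) : ExpGrowth (fun _ : E => a) := of_bounded (fun _ => le_rfl)

lemma of_linear {a b : ℝ} (h : ∀ x, |f x| ≤ a + b * ‖x‖) : ExpGrowth f := by
  refine of_exp_le (a := |a| + |b|) (b := 1) (fun x => (h x).trans ?_)
  have h1 : 1 ≤ Real.exp (1 * ‖x‖) := Real.one_le_exp (by positivity)
  have h2 : ‖x‖ ≤ Real.exp (1 * ‖x‖) := by
    have := Real.add_one_le_exp (1 * ‖x‖); linarith
  have h3 : a ≤ |a| * Real.exp (1 * ‖x‖) :=
    (le_abs_self a).trans (le_mul_of_one_le_right (abs_nonneg a) h1)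
  have h4 : b * ‖x‖ ≤ |b| * Real.exp (1 * ‖x‖) :=
    (mul_le_mul_of_nonneg_right (le_abs_self b) (norm_nonneg x)).trans (by gcongr)
  linarith

lemma norm : ExpGrowth (fun x : E => ‖x‖) :=
  of_linear (a := 0) (b := 1) (by simp)

lemma mul (hf : ExpGrowth f) (hg : ExpGrowth g) : ExpGrowth (fun x => f x * g x) := by
  obtain ⟨C, hC, hf⟩ := hf
  obtain ⟨D, hD, hg⟩ := hg
  refine of_exp_le (a := C * D) (b := C + D) fun x => ?_
  rw [abs_mul, add_mul, Real.exp_add]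
  calc |f x| * |g x| ≤ (C * Real.exp (C * ‖x‖)) * (D * Real.exp (D * ‖x‖)) :=
        mul_le_mul (hf x) (hg x) (abs_nonneg _) (by positivity)
    _ = _ := by ring

lemma add (hf : ExpGrowth f) (hg : ExpGrowth g) : ExpGrowth (fun x => f x + g x) := by
  obtain ⟨C, hC, hf⟩ := hf
  obtain ⟨D, hD, hg⟩ := hg
  refine of_exp_le (a := C + D) (b := C + D) fun x => (abs_add_le _ _).trans ?_
  rw [add_mul]
  refine add_le_add ((hf x).trans ?_) ((hg x).trans ?_)
  · gcongr; linarith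
  · gcongr; linarith

lemma sum {ι : Type*} (s : Finset ι) {f : ι → E → ℝ} (h : ∀ i ∈ s, ExpGrowth (f i)) :
    ExpGrowth (fun x => ∑ i ∈ s, f i x) := by
  classical
  induction s using Finset.induction_on with
  | empty => simpa using const (E := E) 0
  | insert a s ha ih =>
    simp only [Finset.sum_insert ha]
    exact (h a (by simp)).add (ih fun i hi => h i (by simp [hi]))

lemma comp_linear {f : F → ℝ} (hf : ExpGrowth f) {u : E → F} {a : ℝ}
    (hu : ∀ x, ‖u x‖ ≤ a * ‖x‖) : ExpGrowth (fun x => f (u x)) := by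
  obtain ⟨C, hC, hf⟩ := hf
  refine of_exp_le (a := C) (b := C * a) fun x => (hf _).trans ?_
  rw [mul_assoc C a]
  have := hu x
  gcongr

lemma exp_of_linear {a b : ℝ} (h : ∀ x, f x ≤ a + b * ‖x‖) :
    ExpGrowth (fun x => Real.exp (f x)) := by
  refine of_exp_le (a := Real.exp a) (b := b) fun x => ?_
  rw [abs_of_pos (Real.exp_pos _), ← Real.exp_add]
  exact Real.exp_le_exp.2 (h x)

end ExpGrowth

/-! ### Gaussian measures on finite products -/

/-- The standard Gaussian measure on `κ → ℝ`. -/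
abbrev gaussianPi (κ : Type*) [Fintype κ] : Measure (κ → ℝ) :=
  Measure.pi fun _ => gaussianReal 0 1

lemma integrable_exp_mul_abs_gaussianReal (c : ℝ) :
    Integrable (fun t : ℝ => Real.exp (c * |t|)) (gaussianReal 0 1) :=
  integrable_exp_mul_abs (X := fun t : ℝ => t) (integrable_exp_mul_gaussianReal c)
    (integrable_exp_mul_gaussianReal (-c))

variable {κ : Type*} [Fintype κ]

/-- The sup norm is at most the ℓ¹ norm, whose exponential factors over the coordinates. -/
lemma integrable_exp_norm_gaussianPi {c : ℝ} (hc : 0 ≤ c) :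
    Integrable (fun x : κ → ℝ => Real.exp (c * ‖x‖)) (gaussianPi κ) := by
  have h := Integrable.fintype_prod (𝕜 := ℝ) (f := fun (_ : κ) (t : ℝ) => Real.exp (c * |t|))
    (μ := fun _ => gaussianReal 0 1) (fun _ => integrable_exp_mul_abs_gaussianReal c)
  refine h.mono (by fun_prop) (Filter.Eventually.of_forall fun x => ?_)
  rw [Real.norm_of_nonneg (Real.exp_pos _).le,
    Real.norm_of_nonneg (Finset.prod_nonneg fun _ _ => (Real.exp_pos _).le), ← Real.exp_sum,
    ← Finset.mul_sum]
  gcongr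
  refine (pi_norm_le_iff_of_nonneg (Finset.sum_nonneg fun _ _ => abs_nonneg _)).2 fun i => ?_
  exact Finset.single_le_sum (f := fun i => |x i|) (fun _ _ => abs_nonneg _) (Finset.mem_univ i)

lemma ExpGrowth.integrable {f : (κ → ℝ) → ℝ} (hf : ExpGrowth f)
    (hm : AEStronglyMeasurable f (gaussianPi κ)) : Integrable f (gaussianPi κ) := by
  obtain ⟨C, hC, hf⟩ := hf
  refine ((integrable_exp_norm_gaussianPi hC).const_mul C).mono' hm
    (Filter.Eventually.of_forall fun x => ?_)
  simpa using hf x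

/-- Resampling one coordinate preserves a product of probability measures. -/
lemma measurePreserving_update [DecidableEq κ] (μ : κ → Measure ℝ)
    [∀ i, IsProbabilityMeasure (μ i)] (k : κ) :
    MeasurePreserving (fun p : ℝ × (κ → ℝ) => Function.update p.2 k p.1)
      ((μ k).prod (Measure.pi μ)) (Measure.pi μ) := by
  have hmeas : Measurable fun p : ℝ × (κ → ℝ) => Function.update p.2 k p.1 := by
    refine measurable_pi_lambda _ fun i => ?_
    by_cases hi : i = k
    · subst hi; simpa using measurable_fst
    · simp only [Function.update_of_ne hi]
      exact (measurable_pi_apply i).comp measurable_snd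
  refine ⟨hmeas, (Measure.pi_eq fun s hs => ?_).symm⟩
  rw [Measure.map_apply hmeas (MeasurableSet.univ_pi hs)]
  have : (fun p : ℝ × (κ → ℝ) => Function.update p.2 k p.1) ⁻¹' (Set.univ.pi s) =
      s k ×ˢ (Set.univ.pi (Function.update s k Set.univ)) := by
    ext ⟨t, x⟩
    simp only [Set.mem_preimage, Set.mem_pi, Set.mem_univ, true_imp_iff, Set.mem_prod]
    constructor
    · intro h
      refine ⟨by simpa using h k, fun i => ?_⟩
      by_cases hi : i = k
      · subst hi; simp
      · simpa [hi] using h i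
    · rintro ⟨h1, h2⟩ i
      by_cases hi : i = k
      · subst hi; simpa using h1
      · simpa [hi] using h2 i
  rw [this, Measure.prod_prod, Measure.pi_pi, ← Finset.mul_prod_erase _ _ (Finset.mem_univ k),
    ← Finset.mul_prod_erase (Finset.univ) (fun i => μ i (s i)) (Finset.mem_univ k)]
  simp only [Function.update_self, measure_univ, one_mul]
  congr 1
  refine Finset.prod_congr rfl fun i hi => ?_
  rw [Function.update_of_ne (Finset.ne_of_mem_erase hi)]

lemma hasDerivAt_gaussianPDFReal (t : ℝ) :
    HasDerivAt (gaussianPDFReal 0 1) (-t * gaussianPDFReal 0 1 t) t := by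
  have h : HasDerivAt (fun x : ℝ => -(x - 0) ^ 2 / (2 * ((1 : NNReal) : ℝ))) (-t) t := by
    refine ((((hasDerivAt_id t).sub_const 0).pow 2).neg.div_const
      (2 * ((1 : NNReal) : ℝ))).congr_deriv ?_
    simp only [NNReal.coe_one, id, sub_zero]
    norm_num
    ring
  rw [gaussianPDFReal_def]
  refine (h.exp.const_mul (√(2 * Real.pi * ((1 : NNReal) : ℝ)))⁻¹).congr_deriv ?_
  ring

/-- Stein's identity for the one-dimensional standard Gaussian. -/
lemma integral_id_mul_gaussianReal {f f' : ℝ → ℝ} (hf : ∀ t, HasDerivAt f (f' t) t)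
    (h0 : Integrable f (gaussianReal 0 1)) (h1 : Integrable (fun t => t * f t) (gaussianReal 0 1))
    (h2 : Integrable f' (gaussianReal 0 1)) :
    ∫ t, t * f t ∂(gaussianReal 0 1) = ∫ t, f' t ∂(gaussianReal 0 1) := by
  have key : ∀ g : ℝ → ℝ, Integrable g (gaussianReal 0 1) →
      Integrable (fun t => g t * gaussianPDFReal 0 1 t) := by
    intro g hg
    rw [gaussianReal_of_var_ne_zero _ one_ne_zero,
      integrable_withDensity_iff (measurable_gaussianPDF 0 1)
        (Filter.Eventually.of_forall fun _ => gaussianPDF_lt_top)] at hg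
    simpa only [toReal_gaussianPDF] using hg
  have := integral_mul_deriv_eq_deriv_mul_of_integrable (u := f) (v := gaussianPDFReal 0 1)
    (u' := f') (v' := fun t => -t * gaussianPDFReal 0 1 t) (fun t _ => hf t)
    (fun t _ => hasDerivAt_gaussianPDFReal t)
    (by
      refine (key _ h1).neg.congr (Filter.Eventually.of_forall fun t => ?_)
      simp only [Pi.neg_apply, Pi.mul_apply]; ring)
    (key _ h2) (key _ h0)
  rw [integral_gaussianReal_eq_integral_smul one_ne_zero,
    integral_gaussianReal_eq_integral_smul one_ne_zero]
  simp only [smul_eq_mul]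
  have e1 : (fun t => gaussianPDFReal 0 1 t * (t * f t)) =
      fun t => -(f t * (-t * gaussianPDFReal 0 1 t)) := by
    ext t; ring
  rw [e1, integral_neg, this, neg_neg]
  congr 1; ext t; ring

/-- Stein's identity in one coordinate of a standard Gaussian vector. -/
lemma integral_eval_mul_gaussianPi [DecidableEq κ] (k : κ) {f f' : (κ → ℝ) → ℝ}
    (hf : ∀ x, HasDerivAt (fun t => f (Function.update x k t)) (f' x) (x k))
    (h0 : Integrable f (gaussianPi κ)) (h1 : Integrable (fun x => x k * f x) (gaussianPi κ))
    (h2 : Integrable f' (gaussianPi κ)) :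
    ∫ x, x k * f x ∂(gaussianPi κ) = ∫ x, f' x ∂(gaussianPi κ) := by
  -- Resampling coordinate k keeps the law, so an integral can be written as an iterated one with an
  -- inner integral over that coordinate alone. The old value of coordinate k stays in the space but
  -- plays no role.
  have hmp := measurePreserving_update (fun _ : κ => gaussianReal 0 1) k
  have hmp' : MeasurePreserving (fun p : (κ → ℝ) × ℝ => Function.update p.1 k p.2)
      ((gaussianPi κ).prod (gaussianReal 0 1)) (gaussianPi κ) :=
    hmp.comp Measure.measurePreserving_swap
  have key : ∀ g : (κ → ℝ) → ℝ, Integrable g (gaussianPi κ) →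
      Integrable (fun p : (κ → ℝ) × ℝ => g (Function.update p.1 k p.2))
        ((gaussianPi κ).prod (gaussianReal 0 1)) ∧
      ∫ x, g x ∂(gaussianPi κ) =
        ∫ x, ∫ t, g (Function.update x k t) ∂(gaussianReal 0 1) ∂(gaussianPi κ) := by
    intro g hg
    have hi : Integrable (fun p : (κ → ℝ) × ℝ => g (Function.update p.1 k p.2))
        ((gaussianPi κ).prod (gaussianReal 0 1)) := hmp'.integrable_comp_of_integrable hg
    refine ⟨hi, ?_⟩
    rw [← integral_prod _ hi, ← integral_map hmp'.measurable.aemeasurable, hmp'.map_eq]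
    rw [hmp'.map_eq]; exact hg.aestronglyMeasurable
  rw [(key _ h1).2, (key _ h2).2]
  refine integral_congr_ae ?_
  filter_upwards [(key _ h0).1.prod_right_ae, (key _ h1).1.prod_right_ae,
    (key _ h2).1.prod_right_ae] with x i0 i1 i2
  simp only [Function.update_self] at i1 ⊢
  refine integral_id_mul_gaussianReal (fun t => ?_) i0 i1 i2
  simpa using hf (Function.update x k t)

/-! ### Gaussian interpolation -/

section Interpolation

variable {κ : Type*} [Fintype κ] {E : Type*} [NormedAddCommGroup E] [NormedSpace ℝ E]

lemma norm_sum_smul_le (e : κ → E) {c : κ → ℝ} (hc : ∀ k, |c k| ≤ 1) (x : κ → ℝ) :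
    ‖∑ k, (c k * x k) • e k‖ ≤ (∑ k, ‖e k‖) * ‖x‖ := by
  rw [Finset.sum_mul]
  refine norm_sum_le_of_le _ fun k _ => ?_
  rw [norm_smul, mul_comm, Real.norm_eq_abs, abs_mul]
  have h1 : |x k| ≤ ‖x‖ := norm_le_pi_norm x k
  have := mul_le_mul (hc k) h1 (abs_nonneg _) zero_le_one
  gcongr
  linarith

/-- The derivative of a Gaussian expectation along a path of diagonal scalings of the noise. -/
lemma hasDerivAt_integral_gaussianPi {Φ : E → ℝ} (hΦ : ContDiff ℝ 2 Φ) (e : κ → E)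
    (g0 : ExpGrowth Φ) (g1 : ∀ k, ExpGrowth fun z => fderiv ℝ Φ z (e k))
    (g2 : ∀ k, ExpGrowth fun z => fderiv ℝ (fderiv ℝ Φ) z (e k) (e k))
    {c c' : κ → ℝ → ℝ} (hc : ∀ k θ, HasDerivAt (c k) (c' k θ) θ)
    (bc : ∀ k θ, |c k θ| ≤ 1) (bc' : ∀ k θ, |c' k θ| ≤ 1) (θ : ℝ) :
    HasDerivAt (fun θ => ∫ x, Φ (∑ k, (c k θ * x k) • e k) ∂(gaussianPi κ))
      (∑ k, c k θ * c' k θ * ∫ x, fderiv ℝ (fderiv ℝ Φ) (∑ k, (c k θ * x k) • e k) (e k) (e k)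
        ∂(gaussianPi κ)) θ := by
  classical
  set Z : ℝ → (κ → ℝ) → E := fun θ x => ∑ k, (c k θ * x k) • e k with hZ
  have hZb : ∀ θ x, ‖Z θ x‖ ≤ (∑ k, ‖e k‖) * ‖x‖ := fun θ x =>
    norm_sum_smul_le e (fun k => bc k θ) x
  have hZc : ∀ θ, Continuous (Z θ) := fun θ => by fun_prop
  have hd1 : Differentiable ℝ Φ := hΦ.differentiable (by norm_num)
  have hc1 : ContDiff ℝ 1 (fderiv ℝ Φ) := hΦ.fderiv_right (by norm_num)
  have hd2 : Differentiable ℝ (fderiv ℝ Φ) := hc1.differentiable (by norm_num)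
  have hcont1 : Continuous (fderiv ℝ Φ) := hc1.continuous
  have hcont2 : Continuous (fderiv ℝ (fderiv ℝ Φ)) := hc1.continuous_fderiv (by norm_num)
  have hx : ∀ k, ExpGrowth fun x : κ → ℝ => x k := fun k =>
    ExpGrowth.norm.of_le fun x => by simpa using norm_le_pi_norm x k
  have i1 : ∀ k, Integrable (fun x => fderiv ℝ Φ (Z θ x) (e k)) (gaussianPi κ) := fun k =>
    ((g1 k).comp_linear (hZb θ)).integrable (by fun_prop)
  have i1x : ∀ k, Integrable (fun x : κ → ℝ => x k * fderiv ℝ Φ (Z θ x) (e k))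
      (gaussianPi κ) := fun k =>
    ((hx k).mul ((g1 k).comp_linear (hZb θ))).integrable (by fun_prop)
  have i2 : ∀ k, Integrable (fun x => fderiv ℝ (fderiv ℝ Φ) (Z θ x) (e k) (e k))
      (gaussianPi κ) := fun k =>
    ((g2 k).comp_linear (hZb θ)).integrable (by fun_prop)
  -- Differentiating under the integral leaves a factor x k. Stein's identity trades it for one more
  -- derivative of Φ in the direction e k, with the chain-rule factor c k θ.
  have stein : ∀ k, ∫ x, x k * fderiv ℝ Φ (Z θ x) (e k) ∂(gaussianPi κ) =
      c k θ * ∫ x, fderiv ℝ (fderiv ℝ Φ) (Z θ x) (e k) (e k) ∂(gaussianPi κ) := by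
    intro k
    rw [← integral_const_mul]
    refine integral_eval_mul_gaussianPi k (fun x => ?_) (i1 k) (i1x k) ((i2 k).const_mul _)
    have hu : ∀ t, Z θ (Function.update x k t) = Z θ x + (c k θ * (t - x k)) • e k := by
      intro t
      simp only [hZ]
      rw [← Finset.add_sum_erase _ _ (Finset.mem_univ k),
        ← Finset.add_sum_erase _ (fun i => (c i θ * x i) • e i) (Finset.mem_univ k)]
      rw [Finset.sum_congr rfl fun i hi => by
        rw [Function.update_of_ne (Finset.ne_of_mem_erase hi)]]
      simp only [Function.update_self]
      module
    have hline : HasDerivAt (fun t => Z θ (Function.update x k t)) (c k θ • e k) (x k) := by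
      simp only [hu]
      have : HasDerivAt (fun t : ℝ => c k θ * (t - x k)) (c k θ) (x k) := by
        simpa using ((hasDerivAt_id (x k)).sub_const (x k)).const_mul (c k θ)
      exact (this.smul_const (e k)).const_add _
    have h2 := (hd2 (Z θ (Function.update x k (x k)))).hasFDerivAt.comp_hasDerivAt (x k) hline
    rw [Function.update_eq_self] at h2
    have h3 := h2.clm_apply (hasDerivAt_const (x k) (e k))
    refine h3.congr_deriv ?_
    simp
  have gb : ∀ k, ∃ C : ℝ, 0 ≤ C ∧ ∀ z, |fderiv ℝ Φ z (e k)| ≤ C * Real.exp (C * ‖z‖) := g1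
  choose C hC0 hC using gb
  -- The bounds |c|, |c'| ≤ 1 make the dominating function independent of θ, so the whole line
  -- serves as the neighbourhood.
  have hder := hasDerivAt_integral_of_dominated_loc_of_deriv_le (μ := gaussianPi κ) (𝕜 := ℝ)
    (F := fun θ x => Φ (Z θ x)) (x₀ := θ) (s := Set.univ)
    (F' := fun θ x => ∑ k, c' k θ * (x k * fderiv ℝ Φ (Z θ x) (e k)))
    (bound := fun x => ∑ k, ‖x‖ * (C k * Real.exp (C k * ((∑ k, ‖e k‖) * ‖x‖))))
    Filter.univ_mem
    (Filter.Eventually.of_forall fun t => by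
      have := hΦ.continuous
      exact (this.comp (hZc t)).aestronglyMeasurable)
    ((g0.comp_linear (hZb θ)).integrable (hΦ.continuous.comp (hZc θ)).aestronglyMeasurable)
    (by fun_prop)
    (Filter.Eventually.of_forall fun x t _ => by
      refine norm_sum_le_of_le _ fun k _ => ?_
      rw [Real.norm_eq_abs, abs_mul, abs_mul]
      have h1 : |x k| ≤ ‖x‖ := norm_le_pi_norm x k
      have h2 : |fderiv ℝ Φ (Z t x) (e k)| ≤
          C k * Real.exp (C k * ((∑ k, ‖e k‖) * ‖x‖)) := by
        refine (hC k _).trans ?_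
        have := hC0 k
        have := hZb t x
        gcongr
      calc |c' k t| * (|x k| * |fderiv ℝ Φ (Z t x) (e k)|)
          ≤ 1 * (‖x‖ * (C k * Real.exp (C k * ((∑ k, ‖e k‖) * ‖x‖)))) := by
            refine mul_le_mul (bc' k t) (mul_le_mul h1 h2 (abs_nonneg _) (norm_nonneg _))
              (by positivity) zero_le_one
        _ = _ := one_mul _)
    (by
      refine ExpGrowth.integrable (ExpGrowth.sum _ fun k _ => ExpGrowth.norm.mul ?_)
        (by fun_prop)
      refine (ExpGrowth.const _).mul (ExpGrowth.exp_of_linear (a := 0)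
        (b := C k * ∑ k, ‖e k‖) fun x => le_of_eq ?_)
      ring)
    (Filter.Eventually.of_forall fun x t _ => by
      have hZd : HasDerivAt (fun t => Z t x) (∑ k, (c' k t * x k) • e k) t :=
        HasDerivAt.fun_sum fun k _ => ((hc k t).mul_const (x k)).smul_const (e k)
      refine ((hd1 (Z t x)).hasFDerivAt.comp_hasDerivAt t hZd).congr_deriv ?_
      simp [map_sum, mul_assoc])
  refine hder.2.congr_deriv ?_
  rw [integral_finsetSum _ fun k _ => (i1x k).const_mul _]
  refine Finset.sum_congr rfl fun k _ => ?_
  rw [integral_const_mul, stein k]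
  ring

lemma measurePreserving_inl {κ' : Type*} [Fintype κ'] :
    MeasurePreserving (fun (x : κ ⊕ κ' → ℝ) k => x (Sum.inl k)) (gaussianPi (κ ⊕ κ'))
      (gaussianPi κ) :=
  measurePreserving_fst.comp
    (measurePreserving_sumPiEquivProdPi (X := fun _ : κ ⊕ κ' => ℝ) fun _ => gaussianReal 0 1)

lemma measurePreserving_inr {κ' : Type*} [Fintype κ'] :
    MeasurePreserving (fun (x : κ ⊕ κ' → ℝ) k => x (Sum.inr k)) (gaussianPi (κ ⊕ κ'))
      (gaussianPi κ') :=
  measurePreserving_snd.comp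
    (measurePreserving_sumPiEquivProdPi (X := fun _ : κ ⊕ κ' => ℝ) fun _ => gaussianReal 0 1)

lemma integral_comp_inl {κ' : Type*} [Fintype κ'] {f : (κ → ℝ) → ℝ} (hf : Continuous f) :
    ∫ x, f (fun k => x (Sum.inl k)) ∂(gaussianPi (κ ⊕ κ')) = ∫ x, f x ∂(gaussianPi κ) := by
  rw [← (measurePreserving_inl (κ := κ) (κ' := κ')).map_eq,
    integral_map measurePreserving_inl.measurable.aemeasurable hf.aestronglyMeasurable]

lemma integral_comp_inr {κ' : Type*} [Fintype κ'] {f : (κ' → ℝ) → ℝ} (hf : Continuous f) :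
    ∫ x, f (fun k => x (Sum.inr k)) ∂(gaussianPi (κ ⊕ κ')) = ∫ x, f x ∂(gaussianPi κ') := by
  rw [← (measurePreserving_inr (κ := κ) (κ' := κ')).map_eq,
    integral_map measurePreserving_inr.measurable.aemeasurable hf.aestronglyMeasurable]

/-- A Gaussian comparison theorem: if the covariance of `∑ x_k a_k` is dominated by that of
`∑ y_k b_k` along the Hessian of `Φ`, up to `r Φ`, then the expectations of `Φ` compare. -/
theorem integral_gaussianPi_le_of_hessian_le {κ' : Type*} [Fintype κ'] {Φ : E → ℝ}
    (hΦ : ContDiff ℝ 2 Φ) (a : κ → E) (b : κ' → E)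
    (g0 : ExpGrowth Φ) (g1 : ∀ e, ExpGrowth fun z => fderiv ℝ Φ z e)
    (g2 : ∀ e, ExpGrowth fun z => fderiv ℝ (fderiv ℝ Φ) z e e) {r : ℝ}
    (h : ∀ z, ∑ k, fderiv ℝ (fderiv ℝ Φ) z (a k) (a k) ≤
      ∑ k, fderiv ℝ (fderiv ℝ Φ) z (b k) (b k) + r * Φ z) :
    ∫ x, Φ (∑ k, x k • a k) ∂(gaussianPi κ) ≤
      Real.exp (r / 2) * ∫ y, Φ (∑ k, y k • b k) ∂(gaussianPi κ') := by
  set e : κ ⊕ κ' → E := Sum.elim a b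
  set c : κ ⊕ κ' → ℝ → ℝ := Sum.elim (fun _ => Real.cos) (fun _ => Real.sin)
  set c' : κ ⊕ κ' → ℝ → ℝ := Sum.elim (fun _ t => -Real.sin t) (fun _ => Real.cos)
  have hc : ∀ k θ, HasDerivAt (c k) (c' k θ) θ := by
    rintro (k | k) θ
    · exact Real.hasDerivAt_cos θ
    · exact Real.hasDerivAt_sin θ
  have bc : ∀ k θ, |c k θ| ≤ 1 := by
    rintro (k | k) θ
    · exact Real.abs_cos_le_one θ
    · exact Real.abs_sin_le_one θ
  have bc' : ∀ k θ, |c' k θ| ≤ 1 := by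
    rintro (k | k) θ
    · simpa [c'] using Real.abs_sin_le_one θ
    · exact Real.abs_cos_le_one θ
  have hu := hasDerivAt_integral_gaussianPi hΦ e g0 (fun k => g1 _) (fun k => g2 _) hc bc bc'
  set u : ℝ → ℝ := fun θ => ∫ x, Φ (∑ k, (c k θ * x k) • e k) ∂(gaussianPi (κ ⊕ κ')) with hudef
  have hcont2 : Continuous (fderiv ℝ (fderiv ℝ Φ)) :=
    (hΦ.fderiv_right (m := 1) (by norm_num)).continuous_fderiv (by norm_num)
  have i2 : ∀ θ v, Integrable (fun x => fderiv ℝ (fderiv ℝ Φ) (∑ k, (c k θ * x k) • e k) v v)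
      (gaussianPi (κ ⊕ κ')) := fun θ v =>
    ((g2 v).comp_linear (norm_sum_smul_le e fun k => bc k θ)).integrable (((hcont2.comp (by fun_prop)).clm_apply
      continuous_const).clm_apply continuous_const).aestronglyMeasurable
  have i0 : ∀ θ, Integrable (fun x => Φ (∑ k, (c k θ * x k) • e k)) (gaussianPi (κ ⊕ κ')) :=
    fun θ => (g0.comp_linear (norm_sum_smul_le e fun k => bc k θ)).integrable
      (hΦ.continuous.comp (by fun_prop)).aestronglyMeasurable
  have hder : ∀ θ ∈ Set.Ioo 0 (Real.pi / 2), -(r * (Real.sin θ * Real.cos θ) * u θ) ≤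
      ∑ k, c k θ * c' k θ * ∫ x, fderiv ℝ (fderiv ℝ Φ) (∑ k, (c k θ * x k) • e k) (e k) (e k)
        ∂(gaussianPi (κ ⊕ κ')) := by
    intro θ hθ
    have hs := Real.sin_pos_of_pos_of_lt_pi hθ.1 (by linarith [hθ.2, Real.pi_pos])
    have hcs := Real.cos_pos_of_mem_Ioo ⟨by linarith [hθ.1, Real.pi_pos], hθ.2⟩
    have hint : ∑ k, ∫ x, fderiv ℝ (fderiv ℝ Φ) (∑ k, (c k θ * x k) • e k) (a k) (a k)
          ∂(gaussianPi (κ ⊕ κ')) ≤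
        ∑ k, ∫ x, fderiv ℝ (fderiv ℝ Φ) (∑ k, (c k θ * x k) • e k) (b k) (b k)
          ∂(gaussianPi (κ ⊕ κ')) + r * u θ := by
      rw [hudef, ← integral_finsetSum _ fun k _ => i2 θ (a k),
        ← integral_finsetSum _ fun k _ => i2 θ (b k), ← integral_const_mul,
        ← integral_add (integrable_finsetSum _ fun k _ => i2 θ (b k)) ((i0 θ).const_mul r)]
      exact integral_mono (integrable_finsetSum _ fun k _ => i2 θ (a k))
        ((integrable_finsetSum _ fun k _ => i2 θ (b k)).add ((i0 θ).const_mul r)) fun x => h _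
    rw [Fintype.sum_sum_type]
    simp only [c, c', e, Sum.elim_inl, Sum.elim_inr, ← Finset.mul_sum] at hint ⊢
    have := mul_le_mul_of_nonneg_left hint (mul_pos hs hcs).le
    linarith
  -- The integrating factor exp((r/2) sin² θ) has logarithmic derivative r sin θ cos θ, which
  -- absorbs the term r Φ. From 0 to π/2 it contributes exp(r/2).
  have hmono : MonotoneOn (fun θ => u θ * Real.exp (r / 2 * Real.sin θ ^ 2))
      (Set.Icc 0 (Real.pi / 2)) := by
    have hd : ∀ θ, HasDerivAt (fun θ => u θ * Real.exp (r / 2 * Real.sin θ ^ 2)) _ θ := fun θ =>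
      (hu θ).mul ((((Real.hasDerivAt_sin θ).pow 2).const_mul (r / 2)).exp)
    refine monotoneOn_of_deriv_nonneg (convex_Icc _ _)
      (fun θ _ => (hd θ).continuousAt.continuousWithinAt)
      (fun θ _ => (hd θ).differentiableAt.differentiableWithinAt) fun θ hθ => ?_
    rw [interior_Icc] at hθ
    rw [(hd θ).deriv]
    have := mul_le_mul_of_nonneg_right (hder θ hθ) (Real.exp_pos (r / 2 * Real.sin θ ^ 2)).le
    simp only [Nat.cast_ofNat, Nat.add_one_sub_one, pow_one, Pi.pow_apply]
    linarith
  have hle := hmono (Set.left_mem_Icc.2 (by positivity)) (Set.right_mem_Icc.2 (by positivity))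
    (by positivity)
  have e0 : u 0 = ∫ x, Φ (∑ k, x k • a k) ∂(gaussianPi κ) := by
    rw [← integral_comp_inl (κ' := κ') (f := fun x => Φ (∑ k, x k • a k))
      (hΦ.continuous.comp (by fun_prop))]
    simp [hudef, c, e, Fintype.sum_sum_type]
  have e1 : u (Real.pi / 2) = ∫ x, Φ (∑ k, x k • b k) ∂(gaussianPi κ') := by
    rw [← integral_comp_inr (κ := κ) (f := fun x => Φ (∑ k, x k • b k))
      (hΦ.continuous.comp (by fun_prop))]
    simp [hudef, c, e, Fintype.sum_sum_type]
  simp only [e0, e1, Real.sin_zero, Real.sin_pi_div_two] at hle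
  norm_num at hle
  rw [mul_comm]
  simpa using hle

end Interpolation

/-! ### Smoothing of Lipschitz functions -/

section Mollify

lemma integrable_convolution_integrand {V : Type*} [NormedAddCommGroup V] [MeasurableSpace V]
    [BorelSpace V] {μ : Measure V} [IsFiniteMeasureOnCompacts μ]
    {M : V → ℝ} (hM : Continuous M) {F : Type*} [NormedAddCommGroup F] [NormedSpace ℝ F]
    {f : V → F} {G : Type*} [NormedAddCommGroup G] [NormedSpace ℝ G]
    (L : F →L[ℝ] ℝ →L[ℝ] G) (hf : HasCompactSupport f) (hfc : Continuous f) (x : V) :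
    Integrable (fun t => L (f t) (M (x - t))) μ := by
  refine Continuous.integrable_of_hasCompactSupport (by fun_prop) ?_
  exact hf.mono' fun t ht => subset_tsupport _ fun h => ht (by simp [h])

variable {V : Type*} [NormedAddCommGroup V] [NormedSpace ℝ V] [FiniteDimensional ℝ V]
  [MeasurableSpace V] [BorelSpace V]

open scoped Convolution in
/-- A `1`-Lipschitz function is uniformly close to a smooth `1`-Lipschitz function with bounded
second derivative. -/
theorem exists_contDiff_lipschitz_approx [HasContDiffBump V] {M : V → ℝ} (hM : LipschitzWith 1 M)
    {δ : ℝ} (hδ : 0 < δ) :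
    ∃ N : V → ℝ, ContDiff ℝ 2 N ∧ LipschitzWith 1 N ∧
      (∃ C, ∀ x, ‖fderiv ℝ (fderiv ℝ N) x‖ ≤ C) ∧ ∀ x, |N x - M x| ≤ δ := by
  let μ : Measure V := Measure.addHaar
  let φ : ContDiffBump (0 : V) := ⟨δ / 2, δ, by positivity, by linarith⟩
  let N : V → ℝ := (φ.normed μ) ⋆[ContinuousLinearMap.lsmul ℝ ℝ, μ] M
  have hMl : LocallyIntegrable M μ := hM.continuous.locallyIntegrable
  have hcs : HasCompactSupport (φ.normed μ) := φ.hasCompactSupport_normed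
  have hsm : ContDiff ℝ 2 (φ.normed μ) := φ.contDiff_normed
  have hsm1 : ContDiff ℝ 1 (φ.normed μ) := φ.contDiff_normed
  have hN : ContDiff ℝ 2 N := hcs.contDiff_convolution_left _ (n := 2) hsm hMl
  have hMd : ∀ x y t, |M (x - t) - M (y - t)| ≤ ‖x - y‖ := fun x y t => by
    have := hM.dist_le_mul (x - t) (y - t)
    simpa [Real.dist_eq, dist_eq_norm] using this
  have hlip : LipschitzWith 1 N := by
    refine LipschitzWith.of_dist_le_mul fun x y => ?_
    simp only [N, convolution_def, NNReal.coe_one, one_mul, dist_eq_norm]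
    rw [← integral_sub (integrable_convolution_integrand hM.continuous _ hcs hsm.continuous x) (integrable_convolution_integrand hM.continuous _ hcs hsm.continuous y)]
    refine (norm_integral_le_of_norm_le (g := fun t => φ.normed μ t * ‖x - y‖)
      (φ.integrable_normed.mul_const _) (Filter.Eventually.of_forall fun t => ?_)).trans ?_
    · rw [← map_sub]
      simp only [ContinuousLinearMap.lsmul_apply, smul_eq_mul, norm_mul, Real.norm_eq_abs]
      rw [abs_of_nonneg (φ.nonneg_normed t)]
      exact mul_le_mul_of_nonneg_left (hMd x y t) (φ.nonneg_normed t)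
    · rw [integral_mul_const, φ.integral_normed, one_mul]
  refine ⟨N, hN, hlip, ?_, fun x => ?_⟩
  -- The derivative of the convolution can be put on the bump. The gradient of N is then Lipschitz
  -- with constant the L¹ norm of the bump's gradient, which bounds the second derivative.
  · have hD : fderiv ℝ N = fun x => ((fderiv ℝ (φ.normed μ))
        ⋆[(ContinuousLinearMap.lsmul ℝ ℝ : ℝ →L[ℝ] ℝ →L[ℝ] ℝ).precompL V, μ] M) x := by
      ext1 x
      exact (hcs.hasFDerivAt_convolution_left _ hsm1 hMl x).fderiv
    have hcs' : HasCompactSupport (fderiv ℝ (φ.normed μ)) := hcs.fderiv ℝ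
    have hc' : Continuous (fderiv ℝ (φ.normed μ)) := hsm1.continuous_fderiv (by norm_num)
    have hi : Integrable (fderiv ℝ (φ.normed μ)) μ := hc'.integrable_of_hasCompactSupport hcs'
    set K : NNReal := ⟨∫ t, ‖fderiv ℝ (φ.normed μ) t‖ ∂μ, integral_nonneg fun _ => norm_nonneg _⟩
    refine ⟨K, fun x => norm_fderiv_le_of_lipschitz ℝ ?_⟩
    refine LipschitzWith.of_dist_le_mul fun x y => ?_
    simp only [hD, convolution_def, dist_eq_norm]
    rw [← integral_sub (integrable_convolution_integrand hM.continuous _ hcs' hc' x) (integrable_convolution_integrand hM.continuous _ hcs' hc' y)]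
    refine (norm_integral_le_of_norm_le (g := fun t => ‖fderiv ℝ (φ.normed μ) t‖ * ‖x - y‖)
      (hi.norm.mul_const _) (Filter.Eventually.of_forall fun t => ?_)).trans ?_
    · rw [← map_sub]
      refine ContinuousLinearMap.opNorm_le_bound _ (by positivity) fun v => ?_
      rw [ContinuousLinearMap.precompL_apply]
      simp only [ContinuousLinearMap.lsmul_apply, smul_eq_mul, norm_mul, Real.norm_eq_abs]
      have h1 := (fderiv ℝ (φ.normed μ) t).le_opNorm v
      rw [Real.norm_eq_abs] at h1
      calc |(fderiv ℝ (φ.normed μ) t) v| * |M (x - t) - M (y - t)|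
          ≤ (‖fderiv ℝ (φ.normed μ) t‖ * ‖v‖) * ‖x - y‖ :=
            mul_le_mul h1 (hMd x y t) (abs_nonneg _) (by positivity)
        _ = _ := by ring
    · rw [integral_mul_const]
      exact le_rfl
  · rw [← Real.dist_eq]
    refine ContDiffBump.dist_normed_convolution_le hM.continuous.aestronglyMeasurable fun y hy => ?_
    refine (hM.dist_le_mul y x).trans ?_
    simpa using (Metric.mem_ball.1 hy).le

end Mollify

/-! ### Second derivatives along lines -/

section Lines

variable {E : Type*} [NormedAddCommGroup E] [NormedSpace ℝ E] {Φ : E → ℝ}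

lemma hasDerivAt_line (z e : E) (t : ℝ) : HasDerivAt (fun t : ℝ => z + t • e) e t := by
  simpa using ((hasDerivAt_id t).smul_const e).const_add z

lemma hasDerivAt_comp_line (hΦ : Differentiable ℝ Φ) (z e : E) (t : ℝ) :
    HasDerivAt (fun t : ℝ => Φ (z + t • e)) (fderiv ℝ Φ (z + t • e) e) t :=
  (hΦ (z + t • e)).hasFDerivAt.comp_hasDerivAt t (hasDerivAt_line z e t)

lemma hasDerivAt_fderiv_comp_line (hΦ : ContDiff ℝ 2 Φ) (z e : E) :
    HasDerivAt (fun t : ℝ => fderiv ℝ Φ (z + t • e) e) (fderiv ℝ (fderiv ℝ Φ) z e e) 0 := by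
  have hd2 : Differentiable ℝ (fderiv ℝ Φ) :=
    (hΦ.fderiv_right (m := 1) (by norm_num)).differentiable (by norm_num)
  have h := (hd2 (z + (0 : ℝ) • e)).hasFDerivAt.comp_hasDerivAt (0 : ℝ) (hasDerivAt_line z e 0)
  have h3 : HasDerivAt (fun t : ℝ => fderiv ℝ Φ (z + t • e) e)
      (fderiv ℝ (fderiv ℝ Φ) (z + (0 : ℝ) • e) e e) 0 := by
    have := (ContinuousLinearMap.apply ℝ ℝ e).hasFDerivAt.comp_hasDerivAt (0 : ℝ) h
    exact this
  rwa [zero_smul, add_zero] at h3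

/-- Reduces a Hessian form on the diagonal to a second derivative in one real variable, so the
Hessians of the exponential and log-sum-exp composites come from one-variable calculus. -/
lemma fderiv_fderiv_apply_eq (hΦ : ContDiff ℝ 2 Φ) {z e : E} {f' : ℝ → ℝ} {f'' : ℝ}
    (h1 : ∀ t : ℝ, HasDerivAt (fun t : ℝ => Φ (z + t • e)) (f' t) t) (h2 : HasDerivAt f' f'' 0) :
    fderiv ℝ (fderiv ℝ Φ) z e e = f'' := by
  have hf' : f' = fun t => fderiv ℝ Φ (z + t • e) e := by
    ext t
    exact (h1 t).unique (hasDerivAt_comp_line (hΦ.differentiable (by norm_num)) z e t)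
  rw [hf'] at h2
  exact (hasDerivAt_fderiv_comp_line hΦ z e).unique h2

end Lines

/-! ### Gaussian concentration -/

section Concentration

lemma sum_sq_apply_le_one {κ : Type*} [Fintype κ] {V : Type*} [NormedAddCommGroup V]
    [InnerProductSpace ℝ V] (b : OrthonormalBasis κ ℝ V) {L : V →L[ℝ] ℝ}
    (hL : ‖L‖ ≤ 1) : ∑ k, L (b k) ^ 2 ≤ 1 := by
  have h := b.norm_dual L
  rw [← h]
  exact pow_le_one₀ (norm_nonneg _) hL

lemma norm_sum_smul_orthonormalBasis_le {κ : Type*} [Fintype κ] {V : Type*} [NormedAddCommGroup V]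
    [InnerProductSpace ℝ V] (b : OrthonormalBasis κ ℝ V)
    (x : κ → ℝ) : ‖∑ k, x k • b k‖ ≤ (Fintype.card κ : ℝ) * ‖x‖ := by
  have := norm_sum_smul_le (κ := κ) b (c := fun _ => 1) (by simp) x
  simpa using this

lemma _root_.LipschitzWith.abs_le_add_norm {E : Type*} [NormedAddCommGroup E] {M : E → ℝ}
    (hM : LipschitzWith 1 M) (x : E) : |M x| ≤ |M 0| + 1 * ‖x‖ := by
  have h := hM.dist_le_mul x 0
  simp only [Real.dist_eq, NNReal.coe_one, dist_zero_right] at h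
  have := abs_sub_abs_le_abs_sub (M x) (M 0)
  linarith

lemma _root_.LipschitzWith.expGrowth {E : Type*} [NormedAddCommGroup E] {M : E → ℝ} (hM : LipschitzWith 1 M) : ExpGrowth M :=
  ExpGrowth.of_linear hM.abs_le_add_norm

lemma _root_.LipschitzWith.expGrowth_exp {E : Type*} [NormedAddCommGroup E] {M : E → ℝ} (hM : LipschitzWith 1 M) (s : ℝ) :
    ExpGrowth (fun x => Real.exp (s * M x)) := by
  refine ExpGrowth.exp_of_linear (a := |s| * |M 0|) (b := |s|) fun x => (le_abs_self _).trans ?_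
  rw [abs_mul, ← mul_add]
  have := hM.abs_le_add_norm x
  gcongr
  simpa using this

variable {V : Type*} [NormedAddCommGroup V] [InnerProductSpace ℝ V] [FiniteDimensional ℝ V]
  [MeasurableSpace V] [BorelSpace V]

lemma integral_stdGaussian_eq {κ : Type*} [Fintype κ] (b : OrthonormalBasis κ ℝ V) {f : V → ℝ}
    (hf : Continuous f) :
    ∫ x, f x ∂(stdGaussian V) = ∫ x, f (∑ k, x k • b k) ∂(gaussianPi κ) := by
  rw [stdGaussian_eq_map_pi_orthonormalBasis b, integral_map (Measurable.aemeasurable (by fun_prop)) hf.aestronglyMeasurable]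

lemma ExpGrowth.integrable_stdGaussian {f : V → ℝ} (hg : ExpGrowth f) (hf : Continuous f) :
    Integrable f (stdGaussian V) := by
  rw [stdGaussian, integrable_map_measure hf.aestronglyMeasurable (Measurable.aemeasurable (by fun_prop))]
  exact (hg.comp_linear (norm_sum_smul_orthonormalBasis_le (stdOrthonormalBasis ℝ V))).integrable
    (hf.comp (by fun_prop)).aestronglyMeasurable

lemma _root_.LipschitzWith.integrable_stdGaussian {M : V → ℝ} (hM : LipschitzWith 1 M) :
    Integrable M (stdGaussian V) :=
  hM.expGrowth.integrable_stdGaussian hM.continuous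

lemma _root_.LipschitzWith.integrable_exp_stdGaussian {M : V → ℝ} (hM : LipschitzWith 1 M)
    (s : ℝ) : Integrable (fun x => Real.exp (s * M x)) (stdGaussian V) := by
  have := hM.continuous
  exact (hM.expGrowth_exp s).integrable_stdGaussian (by fun_prop)

/-- Doubling inequality for the moment generating function of a smooth Lipschitz function. -/
lemma integral_exp_le_sq_of_contDiff {M : V → ℝ} (hM : ContDiff ℝ 2 M) (hL : LipschitzWith 1 M)
    {C : ℝ} (hC : ∀ x, ‖fderiv ℝ (fderiv ℝ M) x‖ ≤ C) (s : ℝ) :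
    ∫ x, Real.exp (2 * s * M x) ∂(stdGaussian V) ≤
      Real.exp (s ^ 2) * (∫ x, Real.exp (s * M x) ∂(stdGaussian V)) ^ 2 := by
  have hMc := hM.continuous
  have hMd : Differentiable ℝ M := hM.differentiable (by norm_num)
  have hL1 : ∀ x, ‖fderiv ℝ M x‖ ≤ 1 := fun x => by simpa using norm_fderiv_le_of_lipschitz ℝ hL
  have hA : ∀ x e, |fderiv ℝ M x e| ≤ ‖e‖ := fun x e => by
    have := (fderiv ℝ M x).le_of_opNorm_le (hL1 x) e
    simpa using this
  have hB : ∀ x e, |fderiv ℝ (fderiv ℝ M) x e e| ≤ C * ‖e‖ * ‖e‖ := fun x e => by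
    have := (fderiv ℝ (fderiv ℝ M) x).le_of_opNorm₂_le_of_le (hC x) le_rfl le_rfl (x := e) (y := e)
    simpa using this
  set Φ : V × V → ℝ := fun z => Real.exp (s * (M z.1 + M z.2)) with hΦdef
  have hΦ : ContDiff ℝ 2 Φ := by fun_prop
  have hl1 : ∀ (z e : V × V) (t : ℝ), HasDerivAt (fun t : ℝ => Φ (z + t • e))
      (Φ (z + t • e) * (s * (fderiv ℝ M (z.1 + t • e.1) e.1 + fderiv ℝ M (z.2 + t • e.2) e.2)))
      t := fun z e t =>
    (((hasDerivAt_comp_line hMd z.1 e.1 t).add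
      (hasDerivAt_comp_line hMd z.2 e.2 t)).const_mul s).exp
  have hD1 : ∀ z e : V × V, fderiv ℝ Φ z e =
      Φ z * (s * (fderiv ℝ M z.1 e.1 + fderiv ℝ M z.2 e.2)) := by
    intro z e
    have := (hasDerivAt_comp_line (hΦ.differentiable (by norm_num)) z e 0).unique (hl1 z e 0)
    simpa using this
  have hD2 : ∀ z e : V × V, fderiv ℝ (fderiv ℝ Φ) z e e =
      Φ z * (s ^ 2 * (fderiv ℝ M z.1 e.1 + fderiv ℝ M z.2 e.2) ^ 2 +
        s * (fderiv ℝ (fderiv ℝ M) z.1 e.1 e.1 + fderiv ℝ (fderiv ℝ M) z.2 e.2 e.2)) := by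
    intro z e
    refine fderiv_fderiv_apply_eq hΦ (hl1 z e) ?_
    refine ((hl1 z e 0).mul (((hasDerivAt_fderiv_comp_line hM z.1 e.1).add
      (hasDerivAt_fderiv_comp_line hM z.2 e.2)).const_mul s)).congr_deriv ?_
    simp only [zero_smul, add_zero, Pi.add_apply]
    ring
  have g0 : ExpGrowth Φ := by
    refine ExpGrowth.exp_of_linear (a := |s| * (2 * |M 0|)) (b := |s| * 2)
      fun z => (le_abs_self _).trans ?_
    rw [abs_mul, mul_assoc, ← mul_add]
    gcongr
    have h1 := hL.abs_le_add_norm z.1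
    have h2 := hL.abs_le_add_norm z.2
    have h3 := norm_fst_le z
    have h4 := norm_snd_le z
    have := abs_add_le (M z.1) (M z.2)
    linarith
  have g1 : ∀ e, ExpGrowth fun z => fderiv ℝ Φ z e := fun e => by
    simp only [hD1]
    refine g0.mul (ExpGrowth.of_bounded (a := |s| * (‖e.1‖ + ‖e.2‖)) fun z => ?_)
    rw [abs_mul]
    gcongr
    exact (abs_add_le _ _).trans (add_le_add (hA _ _) (hA _ _))
  have g2 : ∀ e, ExpGrowth fun z => fderiv ℝ (fderiv ℝ Φ) z e e := fun e => by
    simp only [hD2]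
    refine g0.mul (ExpGrowth.add ?_ ?_)
    · refine ExpGrowth.of_bounded (a := s ^ 2 * (‖e.1‖ + ‖e.2‖) ^ 2) fun z => ?_
      rw [abs_mul, abs_pow, abs_pow, sq_abs]
      gcongr
      exact (abs_add_le _ _).trans (add_le_add (hA _ _) (hA _ _))
    · refine ExpGrowth.of_bounded
        (a := |s| * (C * ‖e.1‖ * ‖e.1‖ + C * ‖e.2‖ * ‖e.2‖)) fun z => ?_
      rw [abs_mul]
      gcongr
      exact (abs_add_le _ _).trans (add_le_add (hB _ _) (hB _ _))
  let b := stdOrthonormalBasis ℝ V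
  -- The first family feeds the same noise to both arguments, the second feeds independent noise.
  -- The second derivatives of M cancel, as do the squared gradients. The surplus is the cross term
  -- 2s²⟨∇M(z.1), ∇M(z.2)⟩Φ ≤ 2s²Φ, whence r = 2s².
  have hmain := integral_gaussianPi_le_of_hessian_le hΦ (fun k => (b k, b k))
    (Sum.elim (fun k => (b k, (0 : V))) (fun k => ((0 : V), b k))) g0 g1 g2 (r := 2 * s ^ 2) ?_
  · have e1 : ∫ x, Real.exp (2 * s * M x) ∂(stdGaussian V) =
        ∫ x, Φ (∑ k, x k • (b k, b k)) ∂(gaussianPi _) := by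
      rw [integral_stdGaussian_eq b (by fun_prop)]
      refine integral_congr_ae (Filter.Eventually.of_forall fun x => ?_)
      simp only [hΦdef, Prod.fst_sum, Prod.snd_sum, Prod.smul_mk]
      congr 1; ring
    have e2 : ∫ y, Φ (∑ k, y k • (Sum.elim (fun k => (b k, (0 : V)))
        (fun k => ((0 : V), b k)) : _ → V × V) k) ∂(gaussianPi _) =
        (∫ x, Real.exp (s * M x) ∂(stdGaussian V)) ^ 2 := by
      rw [integral_stdGaussian_eq b (by fun_prop), sq, ← integral_prod_mul,
        ← (measurePreserving_sumPiEquivProdPi (X := fun _ => ℝ)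
          fun _ => gaussianReal 0 1).integral_comp']
      refine integral_congr_ae (Filter.Eventually.of_forall fun x => ?_)
      simp only [hΦdef, Prod.fst_sum, Prod.snd_sum, Fintype.sum_sum_type, Sum.elim_inl,
        Sum.elim_inr, Prod.smul_mk, smul_zero, Prod.fst_add, Prod.snd_add,
        Finset.sum_const_zero, add_zero, zero_add, MeasurableEquiv.coe_sumPiEquivProdPi,
        Equiv.sumPiEquivProdPi_apply, mul_add, Real.exp_add]
    rw [e1, ← e2]
    refine hmain.trans_eq ?_
    congr 2; ring
  · intro z
    simp only [hD2, Fintype.sum_sum_type, Sum.elim_inl, Sum.elim_inr, ← Finset.mul_sum]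
    have h1 := sum_sq_apply_le_one b (hL1 z.1)
    have h2 := sum_sq_apply_le_one b (hL1 z.2)
    have h3 : ∑ k, 2 * (fderiv ℝ M z.1 (b k) * fderiv ℝ M z.2 (b k)) ≤ 2 := by
      calc _ ≤ ∑ k, (fderiv ℝ M z.1 (b k) ^ 2 + fderiv ℝ M z.2 (b k) ^ 2) :=
            Finset.sum_le_sum fun k _ => by
              nlinarith [sq_nonneg (fderiv ℝ M z.1 (b k) - fderiv ℝ M z.2 (b k))]
        _ ≤ 2 := by rw [Finset.sum_add_distrib]; linarith
    have hpos : 0 ≤ Φ z * s ^ 2 := mul_nonneg (Real.exp_pos _).le (sq_nonneg s)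
    have h4 := mul_le_mul_of_nonneg_left h3 hpos
    simp only [map_zero, add_zero, zero_add, add_sq,
      Finset.sum_add_distrib, mul_add, ← Finset.mul_sum] at h4 ⊢
    simp only [mul_assoc, ← Finset.mul_sum] at h4 ⊢
    linarith

/-- A sharp doubling inequality for moment generating functions of Lipschitz functions. -/
lemma integral_exp_le_sq {M : V → ℝ} (hL : LipschitzWith 1 M) (s : ℝ) :
    ∫ x, Real.exp (2 * s * M x) ∂(stdGaussian V) ≤
      Real.exp (s ^ 2) * (∫ x, Real.exp (s * M x) ∂(stdGaussian V)) ^ 2 := by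
  -- A smooth N within δ of M changes each exponential moment by a controlled factor, which tends to
  -- 1 as δ → 0.
  have key : ∀ δ : ℝ, 0 < δ → ∫ x, Real.exp (2 * s * M x) ∂(stdGaussian V) ≤
      Real.exp (2 * |s| * δ) * (Real.exp (s ^ 2) *
        (Real.exp (|s| * δ) * ∫ x, Real.exp (s * M x) ∂(stdGaussian V)) ^ 2) := by
    intro δ hδ
    obtain ⟨N, hN, hNL, ⟨C, hC⟩, hclose⟩ := exists_contDiff_lipschitz_approx hL hδ
    have h1 : ∀ (r : ℝ) x, r * M x ≤ |r| * δ + r * N x := fun r x => by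
      have := mul_le_mul_of_nonneg_left (hclose x) (abs_nonneg r)
      rw [← abs_mul] at this
      have := neg_abs_le (r * (N x - M x))
      linarith
    have h2 : ∀ (r : ℝ) x, r * N x ≤ |r| * δ + r * M x := fun r x => by
      have := mul_le_mul_of_nonneg_left (hclose x) (abs_nonneg r)
      rw [← abs_mul] at this
      have := le_abs_self (r * (N x - M x))
      linarith
    have a1 : ∫ x, Real.exp (2 * s * M x) ∂(stdGaussian V) ≤
        Real.exp (2 * |s| * δ) * ∫ x, Real.exp (2 * s * N x) ∂(stdGaussian V) := by
      rw [← integral_const_mul]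
      refine integral_mono (hL.integrable_exp_stdGaussian _)
        ((hNL.integrable_exp_stdGaussian _).const_mul _) fun x => ?_
      simp only [← Real.exp_add]
      have := h1 (2 * s) x
      rw [abs_mul, abs_two] at this
      exact Real.exp_le_exp.2 this
    have a2 : ∫ x, Real.exp (s * N x) ∂(stdGaussian V) ≤
        Real.exp (|s| * δ) * ∫ x, Real.exp (s * M x) ∂(stdGaussian V) := by
      rw [← integral_const_mul]
      refine integral_mono (hNL.integrable_exp_stdGaussian _)
        ((hL.integrable_exp_stdGaussian _).const_mul _) fun x => ?_
      simp only [← Real.exp_add]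
      exact Real.exp_le_exp.2 (h2 s x)
    have a3 : 0 ≤ ∫ x, Real.exp (s * N x) ∂(stdGaussian V) :=
      integral_nonneg fun x => (Real.exp_pos _).le
    refine a1.trans ?_
    gcongr
    refine (integral_exp_le_sq_of_contDiff hN hNL hC s).trans ?_
    gcongr
  have hlim : Filter.Tendsto (fun δ : ℝ => Real.exp (2 * |s| * δ) * (Real.exp (s ^ 2) *
        (Real.exp (|s| * δ) * ∫ x, Real.exp (s * M x) ∂(stdGaussian V)) ^ 2))
      (nhdsWithin 0 (Set.Ioi 0)) (nhds (Real.exp (2 * |s| * 0) * (Real.exp (s ^ 2) *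
        (Real.exp (|s| * 0) * ∫ x, Real.exp (s * M x) ∂(stdGaussian V)) ^ 2))) := by
    refine Filter.Tendsto.mono_left (Continuous.tendsto ?_ 0) nhdsWithin_le_nhds
    fun_prop
  have := ge_of_tendsto hlim (eventually_nhdsWithin_of_forall fun δ hδ => key δ hδ)
  simpa using this

/-- A second-order Taylor bound valid for every real y. Its remainder stays integrable when y is a
multiple of a Lipschitz function of a Gaussian, which gives the behaviour of the moment generating
function near 0. -/
lemma exp_le_one_add_add_sq_mul (y : ℝ) : Real.exp y ≤ 1 + y + y ^ 2 * Real.exp |y| := by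
  have h1 : 1 ≤ Real.exp |y| := Real.one_le_exp (abs_nonneg y)
  have h2 := mul_le_mul_of_nonneg_left h1 (sq_nonneg y)
  rcases le_or_gt |y| 1 with h | h
  · have := Real.abs_exp_sub_one_sub_id_le h
    have := le_abs_self (Real.exp y - 1 - y)
    linarith
  · rcases lt_abs.1 h with h | h
    · rw [abs_of_pos (by linarith)]
      nlinarith [mul_nonneg (by nlinarith : 0 ≤ y ^ 2 - 1) (Real.exp_pos y).le]
    · have := Real.exp_le_one_iff.2 (by linarith : y ≤ 0)
      nlinarith

/-- The sharp Gaussian concentration inequality for moment generating functions. -/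
theorem integral_exp_le_of_lipschitz {M : V → ℝ} (hL : LipschitzWith 1 M) (s : ℝ) :
    ∫ x, Real.exp (s * M x) ∂(stdGaussian V) ≤
      Real.exp (s ^ 2 / 2 + s * ∫ x, M x ∂(stdGaussian V)) := by
  set ψ : ℝ → ℝ := fun s => ∫ x, Real.exp (s * M x) ∂(stdGaussian V) with hψ
  have hψ0 : ∀ s, 0 ≤ ψ s := fun s => integral_nonneg fun x => (Real.exp_pos _).le
  -- The n-th halving contributes exp((s/2^(n+1))²) to the power 2^n, that is exp(s²/2^(n+2)). The
  -- exponents s²/4 + s²/8 + ... sum to s²/2.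
  have step : ∀ n : ℕ, ψ s ≤ Real.exp (s ^ 2 / 2 * (1 - (1 / 2) ^ n)) * ψ (s / 2 ^ n) ^ (2 ^ n) := by
    intro n
    induction n with
    | zero => simp
    | succ n ih =>
      refine ih.trans ?_
      have h := integral_exp_le_sq hL (s / 2 ^ (n + 1))
      have e : 2 * (s / 2 ^ (n + 1)) = s / 2 ^ n := by field_simp; ring
      rw [e] at h
      have h' : ψ (s / 2 ^ n) ≤ Real.exp ((s / 2 ^ (n + 1)) ^ 2) * ψ (s / 2 ^ (n + 1)) ^ 2 := h
      calc _ ≤ Real.exp (s ^ 2 / 2 * (1 - (1 / 2) ^ n)) *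
            (Real.exp ((s / 2 ^ (n + 1)) ^ 2) * ψ (s / 2 ^ (n + 1)) ^ 2) ^ 2 ^ n := by
            have := hψ0 (s / 2 ^ n)
            gcongr
        _ = _ := by
            rw [mul_pow, ← Real.exp_nat_mul, ← pow_mul, ← mul_assoc, ← Real.exp_add, ← pow_succ']
            congr 2
            push_cast
            simp only [one_div, inv_pow, pow_succ]
            field_simp
            ring
  set D : ℝ := ∫ x, M x ^ 2 * Real.exp (|s| * |M x|) ∂(stdGaussian V) with hD
  have hMc := hL.continuous
  have hDi : Integrable (fun x => M x ^ 2 * Real.exp (|s| * |M x|)) (stdGaussian V) := by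
    refine ExpGrowth.integrable_stdGaussian ?_ (by fun_prop)
    have hg : ExpGrowth (fun x => M x ^ 2) := by
      simpa only [sq] using hL.expGrowth.mul hL.expGrowth
    refine hg.mul (ExpGrowth.exp_of_linear (a := |s| * |M 0|) (b := |s|) fun x => ?_)
    rw [← mul_add]
    have := hL.abs_le_add_norm x
    gcongr
    simpa using this
  have small : ∀ ε : ℝ, |ε| ≤ |s| → ψ ε ≤ Real.exp (ε * (∫ x, M x ∂(stdGaussian V)) + ε ^ 2 * D) := by
    intro ε hε
    have h1 : ψ ε ≤ ∫ x, (1 + ε * M x + ε ^ 2 * (M x ^ 2 * Real.exp (|s| * |M x|)))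
        ∂(stdGaussian V) := by
      refine integral_mono (hL.integrable_exp_stdGaussian ε)
        (((integrable_const _).add (hL.integrable_stdGaussian.const_mul _)).add
          (hDi.const_mul _)) fun x => (exp_le_one_add_add_sq_mul _).trans ?_
      rw [abs_mul, mul_pow, mul_assoc]
      gcongr
    rw [integral_add (f := fun x => 1 + ε * M x)
      ((integrable_const _).add (hL.integrable_stdGaussian.const_mul _))
      (hDi.const_mul _), integral_add (integrable_const _) (hL.integrable_stdGaussian.const_mul _),
      integral_const_mul, integral_const_mul] at h1
    simp only [integral_const, probReal_univ, smul_eq_mul, mul_one] at h1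
    refine h1.trans ?_
    have := Real.add_one_le_exp (ε * (∫ x, M x ∂(stdGaussian V)) + ε ^ 2 * D)
    linarith
  have hD0 : 0 ≤ D := integral_nonneg fun x => by positivity
  -- At ε = s/2^n the quadratic error ε²D, raised to the power 2^n, becomes s²D/2^n and vanishes in
  -- the limit. Only the mean of M survives.
  have fin : ∀ n : ℕ, ψ s ≤ Real.exp (s ^ 2 / 2 + s * (∫ x, M x ∂(stdGaussian V)) +
      s ^ 2 * D * (1 / 2) ^ n) := by
    intro n
    refine (step n).trans ?_
    have h2n : (1 : ℝ) ≤ 2 ^ n := one_le_pow₀ (by norm_num)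
    have hs : |s / 2 ^ n| ≤ |s| := by
      rw [abs_div, abs_of_pos (by positivity : (0 : ℝ) < 2 ^ n)]
      exact div_le_self (abs_nonneg s) h2n
    calc _ ≤ Real.exp (s ^ 2 / 2) * Real.exp (s / 2 ^ n * (∫ x, M x ∂(stdGaussian V)) +
          (s / 2 ^ n) ^ 2 * D) ^ 2 ^ n := by
          have := hψ0 (s / 2 ^ n)
          have := small _ hs
          gcongr
          have : (0 : ℝ) ≤ s ^ 2 / 2 * (1 / 2) ^ n := by positivity
          linarith
      _ = _ := by
          rw [← Real.exp_nat_mul, ← Real.exp_add]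
          congr 1
          push_cast
          simp only [one_div, inv_pow]
          field_simp
          ring
  have hlim : Filter.Tendsto (fun n : ℕ => Real.exp (s ^ 2 / 2 + s * (∫ x, M x ∂(stdGaussian V)) +
      s ^ 2 * D * (1 / 2) ^ n)) Filter.atTop
      (nhds (Real.exp (s ^ 2 / 2 + s * (∫ x, M x ∂(stdGaussian V)) + s ^ 2 * D * 0))) := by
    refine (Real.continuous_exp.tendsto _).comp (tendsto_const_nhds.add (tendsto_const_nhds.mul ?_))
    exact tendsto_pow_atTop_nhds_zero_of_lt_one (by norm_num) (by norm_num)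
  have := ge_of_tendsto' hlim fin
  simpa using this

/-- The sharp Gaussian concentration inequality for Lipschitz functions. -/
theorem stdGaussian_real_ge_le_exp {M : V → ℝ} (hL : LipschitzWith 1 M) {θ : ℝ} (hθ : 0 ≤ θ) :
    (stdGaussian V).real {x | (∫ y, M y ∂(stdGaussian V)) + θ ≤ M x} ≤ Real.exp (-θ ^ 2 / 2) := by
  have h := measure_ge_le_exp_mul_mgf (μ := stdGaussian V) (X := M)
    ((∫ y, M y ∂(stdGaussian V)) + θ) hθ (hL.integrable_exp_stdGaussian θ)
  refine h.trans ?_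
  have h2 := integral_exp_le_of_lipschitz hL θ
  rw [mgf]
  calc _ ≤ Real.exp (-θ * ((∫ y, M y ∂(stdGaussian V)) + θ)) *
        Real.exp (θ ^ 2 / 2 + θ * ∫ x, M x ∂(stdGaussian V)) := by gcongr
    _ = _ := by rw [← Real.exp_add]; congr 1; ring

end Concentration

/-! ### Gordon's comparison inequality -/

/-- The matrix with entries `x`, applied to a vector. -/
def sketch {m n : ℕ} (x : EuclideanSpace ℝ (Fin m × Fin n)) (v : Vec n) : Vec m :=
  Matrix.toEuclideanLin (Matrix.of fun i j => x (i, j)) v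

lemma sketch_apply {m n : ℕ} (x : EuclideanSpace ℝ (Fin m × Fin n)) (v : Vec n) (i : Fin m) :
    sketch x v i = ∑ j, x (i, j) * v j := by
  simp [sketch, Matrix.toLpLin_apply, Matrix.mulVec, dotProduct]

lemma sum_mul_le_one {τ : Type*} [Fintype τ] {f g : τ → ℝ} (hf : ∑ k, f k ^ 2 ≤ 1)
    (hg : ∑ k, g k ^ 2 ≤ 1) : ∑ k, f k * g k ≤ 1 := by
  have : ∑ k, f k * g k ≤ ∑ k, (f k ^ 2 + g k ^ 2) / 2 :=
    Finset.sum_le_sum fun k _ => by nlinarith [sq_nonneg (f k - g k)]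
  rw [← Finset.sum_div, Finset.sum_add_distrib] at this
  linarith

lemma sq_sum_mul {ι : Type*} [Fintype ι] (π f : ι → ℝ) :
    (∑ i, π i * f i) ^ 2 = ∑ i, ∑ i', π i * π i' * (f i * f i') := by
  rw [sq, Finset.sum_mul_sum]
  exact Finset.sum_congr rfl fun i _ => Finset.sum_congr rfl fun i' _ => by ring

lemma sum_sq_sum_mul {ι τ : Type*} [Fintype ι] [Fintype τ] (π : ι → ℝ) (f : ι → τ → ℝ) :
    ∑ k, (∑ i, π i * f i k) ^ 2 = ∑ i, ∑ i', π i * π i' * ∑ k, f i k * f i' k := by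
  simp only [sq_sum_mul, Finset.mul_sum]
  rw [Finset.sum_comm]
  exact Finset.sum_congr rfl fun i _ => Finset.sum_comm

/-- The covariance comparison underlying Gordon's inequality. -/
lemma gordon_covariance_le {ι κ κ' : Type*} [Fintype ι] [Fintype κ] [Fintype κ'] (π : ι → ℝ)
    (hπ : ∀ i, 0 ≤ π i) (p : ι → κ → ℝ) (q : ι → κ' → ℝ) (hp : ∀ i, ∑ k, p i k ^ 2 ≤ 1)
    (hq : ∀ i, ∑ j, q i j ^ 2 ≤ 1) :
    ∑ k, (∑ i, π i * p i k) ^ 2 + ∑ j, (∑ i, π i * q i j) ^ 2 ≤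
      ∑ k, ∑ j, (∑ i, π i * (p i k * q i j)) ^ 2 + (∑ i, π i) ^ 2 := by
  have e2 : ∑ k, ∑ j, (∑ i, π i * (p i k * q i j)) ^ 2 =
      ∑ i, ∑ i', π i * π i' * ((∑ k, p i k * p i' k) * ∑ j, q i j * q i' j) := by
    have := sum_sq_sum_mul (τ := κ × κ') π fun i x => p i x.1 * q i x.2
    rw [Fintype.sum_prod_type] at this
    rw [this]
    refine Finset.sum_congr rfl fun i _ => Finset.sum_congr rfl fun i' _ => ?_
    rw [Finset.sum_mul_sum, Fintype.sum_prod_type]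
    congr 1
    exact Finset.sum_congr rfl fun i _ => Finset.sum_congr rfl fun i' _ => by ring
  have e3 : (∑ i, π i) ^ 2 = ∑ i, ∑ i', π i * π i' * 1 := by
    simpa using sq_sum_mul π fun _ => 1
  rw [sum_sq_sum_mul π p, sum_sq_sum_mul π q, e2, e3, ← Finset.sum_add_distrib, ← Finset.sum_add_distrib]
  refine Finset.sum_le_sum fun i _ => ?_
  rw [← Finset.sum_add_distrib, ← Finset.sum_add_distrib]
  refine Finset.sum_le_sum fun i' _ => ?_
  have h1 := sum_mul_le_one (hp i) (hp i')
  have h2 := sum_mul_le_one (hq i) (hq i')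
  -- The pairwise gap is (1 - ⟨p, p'⟩)(1 - ⟨q, q'⟩), weighted by π i π i'. Both factors are
  -- nonnegative by Cauchy–Schwarz.
  have h3 := mul_nonneg (mul_nonneg (hπ i) (hπ i'))
    (mul_nonneg (sub_nonneg.2 h1) (sub_nonneg.2 h2))
  linarith

/-! ### Calculus of log-sum-exp and the softmax weights. -/

section LogSumExp

variable {ι : Type*} [Fintype ι] [Nonempty ι]

/-- The log-sum-exp function. -/
def logSumExp (r : ι → ℝ) : ℝ := Real.log (∑ i, Real.exp (r i))

lemma sum_exp_pos (r : ι → ℝ) : 0 < ∑ i, Real.exp (r i) :=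
  Finset.sum_pos (fun _ _ => Real.exp_pos _) Finset.univ_nonempty

lemma le_logSumExp (r : ι → ℝ) (i : ι) : r i ≤ logSumExp r := by
  rw [logSumExp, Real.le_log_iff_exp_le (sum_exp_pos r)]
  exact Finset.single_le_sum (f := fun i => Real.exp (r i)) (fun _ _ => (Real.exp_pos _).le)
    (Finset.mem_univ i)

lemma logSumExp_le {r : ι → ℝ} {a : ℝ} (h : ∀ i, r i ≤ a) :
    logSumExp r ≤ a + Real.log (Fintype.card ι) := by
  have hc : (0 : ℝ) < Fintype.card ι := Nat.cast_pos.2 Fintype.card_pos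
  rw [logSumExp, Real.log_le_iff_le_exp (sum_exp_pos r), Real.exp_add, Real.exp_log hc]
  calc _ ≤ ∑ _i : ι, Real.exp a := Finset.sum_le_sum fun i _ => Real.exp_le_exp.2 (h i)
    _ = _ := by simp [mul_comm]

lemma logSumExp_add_const (r : ι → ℝ) (a : ℝ) :
    logSumExp (fun i => r i + a) = logSumExp r + a := by
  simp only [logSumExp, Real.exp_add, ← Finset.sum_mul]
  rw [Real.log_mul (sum_exp_pos r).ne' (Real.exp_pos a).ne', Real.log_exp]

lemma continuous_logSumExp : Continuous (logSumExp (ι := ι)) :=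
  Continuous.log (by fun_prop) fun r => (sum_exp_pos r).ne'

lemma ExpGrowth.logSumExp {E : Type*} [NormedAddCommGroup E] {r : ι → E → ℝ}
    (h : ∀ i, ExpGrowth (r i)) : ExpGrowth fun z => logSumExp fun i => r i z := by
  have hs : ExpGrowth fun z => ∑ i, |r i z| := ExpGrowth.sum _ fun i _ => (h i).of_le fun z => by simp
  refine (hs.add (ExpGrowth.const (Real.log (Fintype.card ι)))).of_le fun z => ?_
  have h0 : 0 ≤ Real.log (Fintype.card ι) := Real.log_natCast_nonneg _
  have h1 : ∀ i, |r i z| ≤ ∑ i, |r i z| := fun i =>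
    Finset.single_le_sum (f := fun i => |r i z|) (fun _ _ => abs_nonneg _) (Finset.mem_univ i)
  have i0 := Classical.arbitrary ι
  refine (abs_le.2 ⟨?_, ?_⟩).trans (le_abs_self _)
  · have := le_logSumExp (fun i => r i z) i0
    have := neg_abs_le (r i0 z)
    have := h1 i0
    linarith
  · exact logSumExp_le fun i => (le_abs_self _).trans (h1 i)

/-- The softmax weights. -/
def softmax (r : ι → ℝ) (i : ι) : ℝ := Real.exp (r i) / ∑ j, Real.exp (r j)

lemma softmax_nonneg (r : ι → ℝ) (i : ι) : 0 ≤ softmax r i :=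
  div_nonneg (Real.exp_pos _).le (sum_exp_pos r).le

lemma softmax_le_one (r : ι → ℝ) (i : ι) : softmax r i ≤ 1 :=
  div_le_one_of_le₀ (Finset.single_le_sum (f := fun i => Real.exp (r i))
    (fun _ _ => (Real.exp_pos _).le) (Finset.mem_univ i)) (sum_exp_pos r).le

lemma abs_sum_softmax_mul_le (r : ι → ℝ) {f a : ι → ℝ} (h : ∀ i, |f i| ≤ a i) :
    |∑ i, softmax r i * f i| ≤ ∑ i, a i := by
  refine (Finset.abs_sum_le_sum_abs _ _).trans (Finset.sum_le_sum fun i _ => ?_)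
  rw [abs_mul, abs_of_nonneg (softmax_nonneg r i)]
  exact (mul_le_of_le_one_left (abs_nonneg _) (softmax_le_one r i)).trans (h i)

lemma hasDerivAt_logSumExp {r : ι → ℝ → ℝ} {r' : ι → ℝ} {t : ℝ}
    (h : ∀ i, HasDerivAt (r i) (r' i) t) :
    HasDerivAt (fun t => logSumExp fun i => r i t) (∑ i, softmax (fun i => r i t) i * r' i) t := by
  refine ((HasDerivAt.fun_sum fun i _ => (h i).exp).log
    (sum_exp_pos fun i => r i t).ne').congr_deriv ?_
  simp only [softmax, Finset.sum_div]
  exact Finset.sum_congr rfl fun i _ => by ring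

/-- Differentiating the weights contributes the softmax variance of r', while differentiating r'
contributes the softmax mean of r''. The subtracted square of the mean is what reverses the
covariance comparison in Gordon's inequality. -/
lemma hasDerivAt_sum_softmax_mul {r r' : ι → ℝ → ℝ} {r'' : ι → ℝ} {t : ℝ}
    (h : ∀ i, HasDerivAt (r i) (r' i t) t) (h' : ∀ i, HasDerivAt (r' i) (r'' i) t) :
    HasDerivAt (fun t => ∑ i, softmax (fun i => r i t) i * r' i t)
      (∑ i, softmax (fun i => r i t) i * (r'' i + r' i t ^ 2) -
        (∑ i, softmax (fun i => r i t) i * r' i t) ^ 2) t := by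
  have hZ : HasDerivAt (fun t => ∑ i, Real.exp (r i t)) (∑ i, Real.exp (r i t) * r' i t) t :=
    HasDerivAt.fun_sum fun i _ => (h i).exp
  have hpos := sum_exp_pos fun i => r i t
  have hZ' : ∑ i, Real.exp (r i t) * r' i t =
      (∑ i, softmax (fun i => r i t) i * r' i t) * ∑ i, Real.exp (r i t) := by
    rw [Finset.sum_mul]
    refine Finset.sum_congr rfl fun i _ => ?_
    simp only [softmax]
    field_simp
  refine (HasDerivAt.fun_sum fun i _ =>
    (((h i).exp).div hZ hpos.ne').mul (h' i)).congr_deriv ?_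
  rw [hZ', sq (∑ i, softmax (fun i => r i t) i * r' i t)]
  obtain ⟨m, hm⟩ : ∃ m, m = ∑ i, softmax (fun i => r i t) i * r' i t := ⟨_, rfl⟩
  have hm2 : m * m = ∑ i, softmax (fun i => r i t) i * r' i t * m := by
    rw [← Finset.sum_mul, ← hm]
  rw [← hm, hm2, ← Finset.sum_sub_distrib]
  refine Finset.sum_congr rfl fun i _ => ?_
  simp only [softmax, Pi.div_apply]
  field_simp
  ring

end LogSumExp

/-! ### The sketch as a function of its matrix, and Hessians of the two Gordon processes. -/

lemma sketch_sub {m n : ℕ} (x y : EuclideanSpace ℝ (Fin m × Fin n)) (v : Vec n) :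
    sketch (x - y) v = sketch x v - sketch y v := by
  ext i
  simp [sketch_apply, sub_mul]

lemma sketch_sub_right {m n : ℕ} (x : EuclideanSpace ℝ (Fin m × Fin n)) (v w : Vec n) :
    sketch x (v - w) = sketch x v - sketch x w := by
  simp [sketch]

lemma norm_sketch_le {m n : ℕ} (x : EuclideanSpace ℝ (Fin m × Fin n)) (v : Vec n) :
    ‖sketch x v‖ ≤ ‖x‖ * ‖v‖ := by
  refine le_of_sq_le_sq ?_ (by positivity)
  rw [mul_pow, EuclideanSpace.real_norm_sq_eq, EuclideanSpace.real_norm_sq_eq,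
    EuclideanSpace.real_norm_sq_eq, Fintype.sum_prod_type, Finset.sum_mul]
  refine Finset.sum_le_sum fun i _ => ?_
  rw [sketch_apply]
  exact Finset.sum_mul_sq_le_sq_mul_sq _ _ _

lemma continuous_sketch {m n : ℕ} (v : Vec n) :
    Continuous fun x : EuclideanSpace ℝ (Fin m × Fin n) => sketch x v := by
  refine (LipschitzWith.of_dist_le_mul (K := ‖v‖₊) fun x y => ?_).continuous
  rw [dist_eq_norm, dist_eq_norm, ← sketch_sub, mul_comm]
  exact norm_sketch_le _ _

lemma sum_smul_basisFun_apply {κ : Type*} [Fintype κ] [DecidableEq κ] (y : κ → ℝ) (k : κ) :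
    (∑ l, y l • EuclideanSpace.basisFun κ ℝ l) k = y k := by
  simp [Pi.single_apply]

/-- Both Gordon processes end up as a function of one Gaussian vector plus a function of another, so
their expectations split. -/
lemma integral_gaussianPi_sum_add {κ κ' : Type*} [Fintype κ] [Fintype κ'] {V V' : Type*}
    [NormedAddCommGroup V] [InnerProductSpace ℝ V] [FiniteDimensional ℝ V] [MeasurableSpace V]
    [BorelSpace V] [NormedAddCommGroup V'] [InnerProductSpace ℝ V'] [FiniteDimensional ℝ V']
    [MeasurableSpace V'] [BorelSpace V'] (b : OrthonormalBasis κ ℝ V)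
    (b' : OrthonormalBasis κ' ℝ V') {f : V → ℝ} {g : V' → ℝ} (hf : Continuous f)
    (hg : Continuous g) (gf : ExpGrowth f) (gg : ExpGrowth g) :
    ∫ x, (f (∑ k, x (Sum.inl k) • b k) + g (∑ k, x (Sum.inr k) • b' k)) ∂(gaussianPi (κ ⊕ κ')) =
      ∫ x, f x ∂(stdGaussian V) + ∫ y, g y ∂(stdGaussian V') := by
  have hfc : Continuous fun x : κ → ℝ => f (∑ k, x k • b k) := hf.comp (by fun_prop)
  have hgc : Continuous fun x : κ' → ℝ => g (∑ k, x k • b' k) := hg.comp (by fun_prop)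
  have i1 : Integrable (fun x : κ → ℝ => f (∑ k, x k • b k)) (gaussianPi κ) :=
    (gf.comp_linear (norm_sum_smul_orthonormalBasis_le b)).integrable hfc.aestronglyMeasurable
  have i2 : Integrable (fun x : κ' → ℝ => g (∑ k, x k • b' k)) (gaussianPi κ') :=
    (gg.comp_linear (norm_sum_smul_orthonormalBasis_le b')).integrable hgc.aestronglyMeasurable
  rw [integral_stdGaussian_eq b hf, integral_stdGaussian_eq b' hg,
    ← integral_comp_inl (κ' := κ') hfc, ← integral_comp_inr (κ := κ) hgc]
  exact integral_add (measurePreserving_inl.integrable_comp_of_integrable i1)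
    (measurePreserving_inr.integrable_comp_of_integrable i2)

/-- Since every q i is a unit vector, summing over j removes it from the terms linear in the
weights, and these agree on both sides, curvature h included. What is left are the subtracted
squares, where `gordon_covariance_le` applies. They carry the factor s², so the sign of s is
immaterial. -/
lemma gordon_hessian_le {ι κ κ' : Type*} [Fintype ι] [Fintype κ] [Fintype κ'] (s : ℝ) (π : ι → ℝ)
    (hπ : ∀ i, 0 ≤ π i) (p h : ι → κ → ℝ) (q : ι → κ' → ℝ) (hp : ∀ i, ∑ k, p i k ^ 2 ≤ 1)
    (hq : ∀ i, ∑ j, q i j ^ 2 = 1) :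
    ∑ k, ∑ j, (∑ i, π i * (s * (q i j ^ 2 * h i k) + (s * (p i k * q i j)) ^ 2) -
        (∑ i, π i * (s * (p i k * q i j))) ^ 2) +
      (∑ i, π i * s ^ 2 - (∑ i, π i * s) ^ 2) ≤
    ∑ k, (∑ i, π i * (s * h i k + (s * p i k) ^ 2) - (∑ i, π i * (s * p i k)) ^ 2) +
      ∑ j, (∑ i, π i * (s * q i j) ^ 2 - (∑ i, π i * (s * q i j)) ^ 2) := by
  have hcov := mul_le_mul_of_nonneg_left
    (gordon_covariance_le π hπ p q hp fun i => (hq i).le) (sq_nonneg s)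
  have hsq : ∀ f : ι → ℝ, (∑ i, π i * (s * f i)) ^ 2 = s ^ 2 * (∑ i, π i * f i) ^ 2 := by
    intro f
    rw [← mul_pow, Finset.mul_sum]
    congr 1
    exact Finset.sum_congr rfl fun i _ => by ring
  have hsq1 : (∑ i, π i * s) ^ 2 = s ^ 2 * (∑ i, π i) ^ 2 := by
    rw [← mul_pow, Finset.mul_sum]
    congr 1
    exact Finset.sum_congr rfl fun i _ => by ring
  have d1 : ∑ k, ∑ j, ∑ i, π i * (s * (q i j ^ 2 * h i k) + (s * (p i k * q i j)) ^ 2) =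
      ∑ k, ∑ i, π i * (s * h i k + (s * p i k) ^ 2) := by
    refine Finset.sum_congr rfl fun k _ => ?_
    rw [Finset.sum_comm]
    refine Finset.sum_congr rfl fun i _ => ?_
    rw [← mul_one (π i * (s * h i k + (s * p i k) ^ 2)), ← hq i, Finset.mul_sum]
    exact Finset.sum_congr rfl fun j _ => by ring
  have d2 : ∑ j, ∑ i, π i * (s * q i j) ^ 2 = ∑ i, π i * s ^ 2 := by
    rw [Finset.sum_comm]
    refine Finset.sum_congr rfl fun i _ => ?_
    rw [← mul_one (π i * s ^ 2), ← hq i, Finset.mul_sum]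
    exact Finset.sum_congr rfl fun j _ => by ring
  simp only [hsq, hsq1, Finset.sum_sub_distrib, d1, d2]
  simp only [mul_add, Finset.mul_sum] at hcov ⊢
  linarith

/-! ### Gordon's inequality for log-sum-exp. -/

section Gordon

variable {ι : Type*} [Fintype ι] [Nonempty ι] {m n : ℕ}

/-- Gordon's comparison for a smooth substitute `ρ` of the norm and the softmax over `v`. -/
lemma integral_logSumExp_sketch_le {v : ι → Vec n} (hv : ∀ i, ‖v i‖ = 1) {ρ : Vec m → ℝ}
    (hρ : ContDiff ℝ 2 ρ) (hL : LipschitzWith 1 ρ) {C : ℝ}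
    (hC : ∀ x, ‖fderiv ℝ (fderiv ℝ ρ) x‖ ≤ C) (s : ℝ) :
    ∫ x, logSumExp (fun i => s * ρ (sketch x (v i)))
        ∂(stdGaussian (EuclideanSpace ℝ (Fin m × Fin n))) ≤
      s * ∫ g, ρ g ∂(stdGaussian (Vec m)) +
        ∫ h, logSumExp (fun i => s * inner ℝ (v i) h) ∂(stdGaussian (Vec n)) := by
  have hρc := hρ.continuous
  have hρd : Differentiable ℝ ρ := hρ.differentiable (by norm_num)
  have hL1 : ∀ x, ‖fderiv ℝ ρ x‖ ≤ 1 := fun x => by simpa using norm_fderiv_le_of_lipschitz ℝ hL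
  have hA : ∀ x e, |fderiv ℝ ρ x e| ≤ ‖e‖ := fun x e => by
    have := (fderiv ℝ ρ x).le_of_opNorm_le (hL1 x) e
    simpa using this
  have hB : ∀ x e, |fderiv ℝ (fderiv ℝ ρ) x e e| ≤ C * ‖e‖ * ‖e‖ := fun x e => by
    have := (fderiv ℝ (fderiv ℝ ρ) x).le_of_opNorm₂_le_of_le (hC x) le_rfl le_rfl (x := e) (y := e)
    simpa using this
  -- Each index carries a vector slot, for S v or g, and a scalar slot, for the auxiliary noise or
  -- ⟨v, h⟩. A single Φ thus serves both processes.
  set r : ι → (ι → Vec m × ℝ) → ℝ := fun i z => s * (ρ (z i).1 + (z i).2) with hr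
  set Φ : (ι → Vec m × ℝ) → ℝ := fun z => logSumExp fun i => r i z with hΦdef
  have hΦ : ContDiff ℝ 2 Φ := by
    refine ContDiff.log ?_ fun z => (sum_exp_pos _).ne'
    fun_prop
  have hr1 : ∀ (z e : ι → Vec m × ℝ) i (t : ℝ), HasDerivAt (fun t : ℝ => r i (z + t • e))
      (s * (fderiv ℝ ρ ((z i).1 + t • (e i).1) (e i).1 + (e i).2)) t := fun z e i t => by
    refine ((hasDerivAt_comp_line hρd (z i).1 (e i).1 t).add
      (?_ : HasDerivAt (fun t : ℝ => (z i).2 + t * (e i).2) (e i).2 t)).const_mul s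
    simpa using ((hasDerivAt_id t).mul_const (e i).2).const_add (z i).2
  have hr2 : ∀ (z e : ι → Vec m × ℝ) i, HasDerivAt
      (fun t : ℝ => s * (fderiv ℝ ρ ((z i).1 + t • (e i).1) (e i).1 + (e i).2))
      (s * fderiv ℝ (fderiv ℝ ρ) (z i).1 (e i).1 (e i).1) 0 := fun z e i =>
    ((hasDerivAt_fderiv_comp_line hρ (z i).1 (e i).1).add_const _).const_mul s
  have hD1 : ∀ z e, fderiv ℝ Φ z e =
      ∑ i, softmax (fun i => r i z) i * (s * (fderiv ℝ ρ (z i).1 (e i).1 + (e i).2)) := by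
    intro z e
    have := (hasDerivAt_comp_line (hΦ.differentiable (by norm_num)) z e 0).unique
      (hasDerivAt_logSumExp fun i => hr1 z e i 0)
    simpa only [zero_smul, add_zero] using this
  have hD2 : ∀ z e, fderiv ℝ (fderiv ℝ Φ) z e e =
      ∑ i, softmax (fun i => r i z) i * (s * fderiv ℝ (fderiv ℝ ρ) (z i).1 (e i).1 (e i).1 +
          (s * (fderiv ℝ ρ (z i).1 (e i).1 + (e i).2)) ^ 2) -
        (∑ i, softmax (fun i => r i z) i *
          (s * (fderiv ℝ ρ (z i).1 (e i).1 + (e i).2))) ^ 2 := by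
    intro z e
    refine fderiv_fderiv_apply_eq hΦ (fun t => hasDerivAt_logSumExp fun i => hr1 z e i t) ?_
    refine (hasDerivAt_sum_softmax_mul (fun i => hr1 z e i 0) (hr2 z e)).congr_deriv ?_
    simp only [zero_smul, add_zero]
  have hbd : ∀ (z e : ι → Vec m × ℝ) i, |s * (fderiv ℝ ρ (z i).1 (e i).1 + (e i).2)| ≤
      |s| * (‖(e i).1‖ + |(e i).2|) := fun z e i => by
    rw [abs_mul]
    gcongr
    exact (abs_add_le _ _).trans (add_le_add (hA _ _) le_rfl)
  have g0 : ExpGrowth Φ := by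
    refine ExpGrowth.logSumExp fun i => (ExpGrowth.const s).mul (ExpGrowth.add ?_ ?_)
    · exact hL.expGrowth.comp_linear (a := 1) (u := fun z : ι → Vec m × ℝ => (z i).1) fun z => by
        rw [one_mul]; exact (norm_fst_le _).trans (norm_le_pi_norm z i)
    · exact ExpGrowth.norm.of_le fun z => by
        rw [abs_norm]; exact (norm_snd_le _).trans (norm_le_pi_norm z i)
  have g1 : ∀ e, ExpGrowth fun z => fderiv ℝ Φ z e := fun e => by
    simp only [hD1]
    exact ExpGrowth.of_bounded fun z => abs_sum_softmax_mul_le _ (hbd z e)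
  have g2 : ∀ e, ExpGrowth fun z => fderiv ℝ (fderiv ℝ Φ) z e e := fun e => by
    simp only [hD2]
    refine ExpGrowth.of_bounded fun z => (abs_sub _ _).trans (add_le_add
      (abs_sum_softmax_mul_le _ fun i => (abs_add_le _ _).trans (add_le_add
        ((abs_mul _ _).trans_le (mul_le_mul_of_nonneg_left (hB _ _) (abs_nonneg s)))
        ((abs_pow _ _).trans_le (pow_le_pow_left₀ (abs_nonneg _) (hbd z e i) 2))))
      ((abs_pow _ _).trans_le (pow_le_pow_left₀ (abs_nonneg _)
        (abs_sum_softmax_mul_le _ (hbd z e)) 2)))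
  let b := EuclideanSpace.basisFun (Fin m) ℝ
  have hvs : ∀ i, ∑ j, v i j ^ 2 = 1 := fun i => by
    rw [← EuclideanSpace.real_norm_sq_eq, hv i, one_pow]
  -- The first family is the entries of S together with one scalar shared by all indices. The second
  -- is a vector g shared by all indices together with h seen through v i.
  have hmain := integral_gaussianPi_le_of_hessian_le hΦ
    (Sum.elim (fun (kj : Fin m × Fin n) (i : ι) => (v i kj.2 • b kj.1, (0 : ℝ)))
      (fun (_ : Unit) (_ : ι) => ((0 : Vec m), (1 : ℝ))))
    (Sum.elim (fun (k : Fin m) (_ : ι) => (b k, (0 : ℝ)))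
      (fun (j : Fin n) (i : ι) => ((0 : Vec m), v i j))) g0 g1 g2 (r := 0) ?_
  · have e1 : ∫ x, Φ (∑ k, x k • (Sum.elim (fun (kj : Fin m × Fin n) (i : ι) =>
          (v i kj.2 • b kj.1, (0 : ℝ))) (fun (_ : Unit) (_ : ι) => ((0 : Vec m), (1 : ℝ)))
          : _ → ι → Vec m × ℝ) k) ∂(gaussianPi _) =
        ∫ x, logSumExp (fun i => s * ρ (sketch x (v i)))
          ∂(stdGaussian (EuclideanSpace ℝ (Fin m × Fin n))) := by
      -- The shared scalar, needed to balance the covariances, only translates the log-sum-exp and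
      -- has mean zero, so it leaves the expectation.
      have h := integral_gaussianPi_sum_add (EuclideanSpace.basisFun (Fin m × Fin n) ℝ)
        (OrthonormalBasis.singleton Unit ℝ)
        (f := fun x => logSumExp (fun i => s * ρ (sketch x (v i)))) (g := fun t => s * t)
        (continuous_logSumExp.comp (continuous_pi fun i =>
          continuous_const.mul (hρc.comp (continuous_sketch (v i))))) (by fun_prop)
        (ExpGrowth.logSumExp fun i => (ExpGrowth.const s).mul
          (hL.expGrowth.comp_linear (a := 1) fun x => by simpa [hv i] using norm_sketch_le x (v i)))
        ((ExpGrowth.const s).mul (ExpGrowth.norm.of_le fun x => by simp))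
      rw [integral_const_mul, integral_id_stdGaussian, mul_zero, add_zero] at h
      rw [← h]
      refine integral_congr_ae (Filter.Eventually.of_forall fun x => ?_)
      simp only [hΦdef, hr]
      rw [← logSumExp_add_const]
      congr 1
      ext i
      rw [← mul_add]
      congr 2
      · congr 1
        ext k
        rw [sketch_apply]
        simp only [sum_smul_basisFun_apply]
        simp only [Finset.sum_apply, Pi.smul_apply, Fintype.sum_sum_type,
          Sum.elim_inl, Sum.elim_inr, Prod.smul_mk, smul_zero, Fintype.sum_prod_type]
        rw [Finset.sum_comm]
        simp [b, Pi.single_apply, Prod.fst_sum]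
      · simp [Fintype.sum_sum_type, Prod.snd_sum]
    have e2 : ∫ x, Φ (∑ k, x k • (Sum.elim (fun (k : Fin m) (_ : ι) => (b k, (0 : ℝ)))
          (fun (j : Fin n) (i : ι) => ((0 : Vec m), v i j)) : _ → ι → Vec m × ℝ) k)
          ∂(gaussianPi _) =
        s * ∫ g, ρ g ∂(stdGaussian (Vec m)) +
          ∫ h, logSumExp (fun i => s * inner ℝ (v i) h) ∂(stdGaussian (Vec n)) := by
      rw [← integral_const_mul]
      rw [← integral_gaussianPi_sum_add b (EuclideanSpace.basisFun (Fin n) ℝ)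
        (f := fun g => s * ρ g) (g := fun h => logSumExp (fun i => s * inner ℝ (v i) h))
        (by fun_prop) (continuous_logSumExp.comp (by fun_prop))
        ((ExpGrowth.const s).mul hL.expGrowth)
        (ExpGrowth.logSumExp fun i => (ExpGrowth.const s).mul (ExpGrowth.norm.of_le fun x => by
          simpa [hv i] using abs_real_inner_le_norm (v i) x))]
      refine integral_congr_ae (Filter.Eventually.of_forall fun x => ?_)
      simp only [hΦdef, hr]
      rw [add_comm, ← logSumExp_add_const]
      congr 1
      ext i
      rw [← mul_add, add_comm (inner ℝ _ _)]
      congr 2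
      · congr 1
        simp [Fintype.sum_sum_type, Prod.fst_sum]
      · simp [Fintype.sum_sum_type, Prod.snd_sum, inner_sum, inner_smul_right,
          EuclideanSpace.inner_single_right]
    rw [← e1, ← e2]
    simpa using hmain
  · intro z
    have := gordon_hessian_le s (softmax fun i => r i z) (softmax_nonneg _)
      (fun i k => fderiv ℝ ρ (z i).1 (b k))
      (fun i k => fderiv ℝ (fderiv ℝ ρ) (z i).1 (b k) (b k)) (fun i j => v i j)
      (fun i => sum_sq_apply_le_one b (hL1 _)) hvs
    simp only [hD2, Fintype.sum_sum_type, Sum.elim_inl, Sum.elim_inr, Fintype.sum_prod_type,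
      map_zero, map_smul, smul_eq_mul, add_zero, zero_add, mul_zero, zero_mul, mul_one,
      Finset.univ_unique, Finset.sum_const, Finset.card_singleton, one_smul,
      _root_.smul_apply]
    refine (le_of_eq ?_).trans this
    congr 1
    refine Finset.sum_congr rfl fun k _ => Finset.sum_congr rfl fun j _ => ?_
    congr 1
    · refine Finset.sum_congr rfl fun i _ => ?_
      ring
    · congr 1
      refine Finset.sum_congr rfl fun i _ => ?_
      ring

end Gordon

/-! ### Gordon's inequality for suprema, and the resulting tail bound. -/

lemma lipschitzWith_sSup_image {α E : Type*} [PseudoMetricSpace E] {T : Set α} (hT : T.Nonempty)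
    {f : α → E → ℝ} (hf : ∀ v ∈ T, LipschitzWith 1 (f v))
    (hb : ∀ x, BddAbove ((fun v => f v x) '' T)) :
    LipschitzWith 1 fun x => sSup ((fun v => f v x) '' T) := by
  refine LipschitzWith.of_le_add fun x y => csSup_le (hT.image _) ?_
  rintro _ ⟨v, hv, rfl⟩
  have h1 : f v y ≤ sSup ((fun v => f v y) '' T) := le_csSup (hb y) ⟨v, hv, rfl⟩
  have h2 := (hf v hv).dist_le_mul x y
  rw [Real.dist_eq, NNReal.coe_one, one_mul] at h2
  have := le_abs_self (f v x - f v y)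
  linarith

section Gordon

variable {m n : ℕ} {ε : ℝ}

lemma lipschitzWith_mul_norm_sketch (hε : |ε| = 1) {v : Vec n} (hv : ‖v‖ = 1) :
    LipschitzWith 1 fun x : EuclideanSpace ℝ (Fin m × Fin n) => ε * ‖sketch x v‖ := by
  refine LipschitzWith.of_dist_le_mul fun x y => ?_
  rw [Real.dist_eq, ← mul_sub, abs_mul, hε, one_mul, NNReal.coe_one, one_mul, dist_eq_norm]
  refine (abs_norm_sub_norm_le _ _).trans ?_
  rw [← sketch_sub]
  simpa [hv] using norm_sketch_le (x - y) v

lemma lipschitzWith_mul_inner (hε : |ε| = 1) {v : Vec n} (hv : ‖v‖ = 1) :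
    LipschitzWith 1 fun x : Vec n => ε * inner ℝ v x := by
  refine LipschitzWith.of_dist_le_mul fun x y => ?_
  rw [Real.dist_eq, ← mul_sub, abs_mul, hε, one_mul, NNReal.coe_one, one_mul, dist_eq_norm,
    ← inner_sub_right]
  simpa [hv] using abs_real_inner_le_norm v (x - y)

lemma abs_mul_norm_sketch_le (hε : |ε| = 1) {v : Vec n} (hv : ‖v‖ = 1)
    (x : EuclideanSpace ℝ (Fin m × Fin n)) : |ε * ‖sketch x v‖| ≤ ‖x‖ := by
  rw [abs_mul, hε, one_mul, abs_norm]
  simpa [hv] using norm_sketch_le x v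

lemma abs_mul_inner_le (hε : |ε| = 1) {v : Vec n} (hv : ‖v‖ = 1) (x : Vec n) :
    |ε * inner ℝ v x| ≤ ‖x‖ := by
  rw [abs_mul, hε, one_mul]
  simpa [hv] using abs_real_inner_le_norm v x

lemma bddAbove_mul_norm_sketch (hε : |ε| = 1) {T : Set (Vec n)} (hT : ∀ v ∈ T, ‖v‖ = 1)
    (x : EuclideanSpace ℝ (Fin m × Fin n)) :
    BddAbove ((fun v => ε * ‖sketch x v‖) '' T) := by
  refine ⟨‖x‖, ?_⟩
  rintro _ ⟨v, hv, rfl⟩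
  exact (le_abs_self _).trans (abs_mul_norm_sketch_le hε (hT v hv) x)

lemma bddAbove_mul_inner (hε : |ε| = 1) {T : Set (Vec n)} (hT : ∀ v ∈ T, ‖v‖ = 1) (x : Vec n) :
    BddAbove ((fun v => ε * inner ℝ v x) '' T) := by
  refine ⟨‖x‖, ?_⟩
  rintro _ ⟨v, hv, rfl⟩
  exact (le_abs_self _).trans (abs_mul_inner_le hε (hT v hv) x)

lemma lipschitzWith_sSup_norm_sketch (hε : |ε| = 1) {T : Set (Vec n)} (hT0 : T.Nonempty)
    (hT : ∀ v ∈ T, ‖v‖ = 1) : LipschitzWith 1 fun x : EuclideanSpace ℝ (Fin m × Fin n) =>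
      sSup ((fun v => ε * ‖sketch x v‖) '' T) :=
  lipschitzWith_sSup_image hT0 (fun _ hv => lipschitzWith_mul_norm_sketch hε (hT _ hv))
    (bddAbove_mul_norm_sketch hε hT)

lemma lipschitzWith_sSup_inner (hε : |ε| = 1) {T : Set (Vec n)} (hT0 : T.Nonempty)
    (hT : ∀ v ∈ T, ‖v‖ = 1) : LipschitzWith 1 fun x : Vec n =>
      sSup ((fun v => ε * inner ℝ v x) '' T) :=
  lipschitzWith_sSup_image hT0 (fun _ hv => lipschitzWith_mul_inner hε (hT _ hv))
    (bddAbove_mul_inner hε hT)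

/-- Gordon's inequality for the minimum (`ε = -1`) and the maximum (`ε = 1`) of `‖S v‖` over a
finite set of unit vectors. -/
theorem gordon_of_finite (hε : |ε| = 1) {t : Set (Vec n)} (ht : t.Finite) (ht0 : t.Nonempty)
    (ht1 : ∀ v ∈ t, ‖v‖ = 1) :
    ∫ x, sSup ((fun v => ε * ‖sketch x v‖) '' t)
        ∂(stdGaussian (EuclideanSpace ℝ (Fin m × Fin n))) ≤
      ε * ∫ g, ‖g‖ ∂(stdGaussian (Vec m)) +
        ∫ h, sSup ((fun v => ε * inner ℝ v h) '' t) ∂(stdGaussian (Vec n)) := by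
  have : Fintype t := ht.fintype
  have : Nonempty t := ht0.to_subtype
  have hLS := lipschitzWith_sSup_norm_sketch (m := m) hε ht0 ht1
  have hLI := lipschitzWith_sSup_inner hε ht0 ht1
  have hLN : LipschitzWith 1 fun x : Vec m => ‖x‖ := lipschitzWith_one_norm
  set lc := Real.log (Fintype.card t) with hlc
  have key : ∀ δ p : ℝ, 0 < δ → 0 < p →
      ∫ x, sSup ((fun v => ε * ‖sketch x v‖) '' t)
        ∂(stdGaussian (EuclideanSpace ℝ (Fin m × Fin n))) ≤
      ε * ∫ g, ‖g‖ ∂(stdGaussian (Vec m)) +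
        ∫ h, sSup ((fun v => ε * inner ℝ v h) '' t) ∂(stdGaussian (Vec n)) + 2 * δ + lc / p := by
    intro δ p hδ hp
    obtain ⟨ρ, hρ, hρL, ⟨C, hC⟩, hclose⟩ := exists_contDiff_lipschitz_approx hLN hδ
    have hρc := hρ.continuous
    -- With p as inverse temperature, log-sum-exp divided by p exceeds the maximum by at most
    -- log(card)/p. The sign ε is carried by the parameter p ε, so a minimum of norms is treated as
    -- a maximum of their negatives.
    have h := integral_logSumExp_sketch_le (m := m) (v := fun i : t => (i : Vec n))
      (fun i => ht1 i i.2) hρ hρL hC (p * ε)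
    have hερ : ∀ x, |ε * ρ x - ε * ‖x‖| ≤ δ := fun x => by
      rw [← mul_sub, abs_mul, hε, one_mul]; exact hclose x
    have i1 : Integrable (fun x => logSumExp fun i : t => p * ε * ρ (sketch x (i : Vec n)))
        (stdGaussian (EuclideanSpace ℝ (Fin m × Fin n))) := by
      refine ExpGrowth.integrable_stdGaussian (ExpGrowth.logSumExp fun i =>
        (ExpGrowth.const (p * ε)).mul (hρL.expGrowth.comp_linear (a := 1) fun x => by
          simpa [ht1 i i.2] using norm_sketch_le x (i : Vec n)))
        (continuous_logSumExp.comp (continuous_pi fun i =>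
          continuous_const.mul (hρc.comp (continuous_sketch _))))
    have i2 : Integrable (fun h => logSumExp fun i : t => p * ε * inner ℝ (i : Vec n) h)
        (stdGaussian (Vec n)) := by
      refine ExpGrowth.integrable_stdGaussian (ExpGrowth.logSumExp fun i =>
        (ExpGrowth.const (p * ε)).mul (ExpGrowth.norm.of_le fun x => by
          simpa [ht1 i i.2] using abs_real_inner_le_norm (i : Vec n) x))
        (continuous_logSumExp.comp (by fun_prop))
    have a1 : p * (∫ x, sSup ((fun v => ε * ‖sketch x v‖) '' t)
        ∂(stdGaussian (EuclideanSpace ℝ (Fin m × Fin n)))) ≤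
        ∫ x, logSumExp (fun i : t => p * ε * ρ (sketch x (i : Vec n)))
          ∂(stdGaussian (EuclideanSpace ℝ (Fin m × Fin n))) + p * δ := by
      have : p * δ = ∫ _x, p * δ ∂(stdGaussian (EuclideanSpace ℝ (Fin m × Fin n))) := by simp
      rw [this, ← integral_const_mul, ← integral_add i1 (integrable_const _)]
      refine integral_mono (hLS.integrable_stdGaussian.const_mul p) (i1.add (integrable_const _))
        fun x => ?_
      rw [← le_div_iff₀' hp]
      refine csSup_le (ht0.image _) ?_
      rintro _ ⟨v, hv, rfl⟩
      rw [le_div_iff₀' hp]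
      have h1 := le_logSumExp (fun i : t => p * ε * ρ (sketch x (i : Vec n))) ⟨v, hv⟩
      have h2 := (abs_le.1 (hερ (sketch x v))).1
      have h3 := mul_le_mul_of_nonneg_left h2 hp.le
      dsimp only at h1 ⊢
      linarith
    have a2 : ε * ∫ x, ρ x ∂(stdGaussian (Vec m)) ≤ ε * ∫ g, ‖g‖ ∂(stdGaussian (Vec m)) + δ := by
      have : δ = ∫ _x, δ ∂(stdGaussian (Vec m)) := by simp
      rw [this, ← integral_const_mul, ← integral_const_mul,
        ← integral_add (hLN.integrable_stdGaussian.const_mul ε) (integrable_const _)]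
      refine integral_mono (hρL.integrable_stdGaussian.const_mul ε)
        ((hLN.integrable_stdGaussian.const_mul ε).add (integrable_const _)) fun x => ?_
      have := (abs_le.1 (hερ x)).2
      dsimp only
      linarith
    have a3 : ∫ h, logSumExp (fun i : t => p * ε * inner ℝ (i : Vec n) h) ∂(stdGaussian (Vec n)) ≤
        p * ∫ h, sSup ((fun v => ε * inner ℝ v h) '' t) ∂(stdGaussian (Vec n)) + lc := by
      have : lc = ∫ _x, lc ∂(stdGaussian (Vec n)) := by simp
      rw [this, ← integral_const_mul,
        ← integral_add (hLI.integrable_stdGaussian.const_mul p) (integrable_const _)]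
      refine integral_mono i2 ((hLI.integrable_stdGaussian.const_mul p).add (integrable_const _))
        fun x => logSumExp_le fun i => ?_
      rw [mul_assoc]
      exact mul_le_mul_of_nonneg_left
        (le_csSup (bddAbove_mul_inner hε ht1 x) ⟨i, i.2, rfl⟩) hp.le
    have a4 := mul_le_mul_of_nonneg_left a2 hp.le
    have a5 : p * (lc / p) = lc := by field_simp
    refine le_of_mul_le_mul_left ?_ hp
    linarith
  refine le_of_forall_pos_le_add fun η hη => ?_
  have hlc0 : 0 ≤ lc := Real.log_natCast_nonneg _
  -- The two smoothing errors 2δ and lc/p are each made at most η/2. The summand 1 in lc + 1 keeps p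
  -- positive when t is a single point.
  have := key (η / 4) (2 * (lc + 1) / η) (by positivity) (by positivity)
  have h2 : lc / (2 * (lc + 1) / η) ≤ η / 2 := by
    rw [div_le_iff₀ (by positivity)]
    field_simp
    linarith
  linarith

/-- Gordon's inequality for arbitrary sets of unit vectors. -/
theorem gordon (hε : |ε| = 1) {T : Set (Vec n)} (hT0 : T.Nonempty) (hT : ∀ v ∈ T, ‖v‖ = 1) :
    ∫ x, sSup ((fun v => ε * ‖sketch x v‖) '' T)
        ∂(stdGaussian (EuclideanSpace ℝ (Fin m × Fin n))) ≤
      ε * ∫ g, ‖g‖ ∂(stdGaussian (Vec m)) +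
        ∫ h, sSup ((fun v => ε * inner ℝ v h) '' T) ∂(stdGaussian (Vec n)) := by
  set B := ∫ x, ‖x‖ ∂(stdGaussian (EuclideanSpace ℝ (Fin m × Fin n)))
  have hB : 0 ≤ B := integral_nonneg fun x => norm_nonneg x
  have hLN : LipschitzWith 1 fun x : EuclideanSpace ℝ (Fin m × Fin n) => ‖x‖ :=
    lipschitzWith_one_norm
  have htb : TotallyBounded T := (isCompact_sphere (0 : Vec n) 1).totallyBounded.subset
    fun v hv => by simpa using hT v hv
  refine le_of_forall_pos_le_add fun η hη => ?_
  set δ := η / (B + 1)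
  have hδ : 0 < δ := by positivity
  -- The net is taken inside T, so its points are unit vectors and its width is at most that of T.
  -- Passing from T to the net costs δ‖x‖ pointwise, hence δB ≤ η in mean.
  obtain ⟨t, htT, htf, htc⟩ := totallyBounded_iff_subset.1 htb _ (Metric.dist_mem_uniformity hδ)
  have ht1 : ∀ v ∈ t, ‖v‖ = 1 := fun v hv => hT v (htT hv)
  have hcov : ∀ v ∈ T, ∃ w ∈ t, dist v w < δ := fun v hv => by simpa using htc hv
  have ht0 : t.Nonempty := by
    obtain ⟨v, hv⟩ := hT0
    obtain ⟨w, hw, -⟩ := hcov v hv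
    exact ⟨w, hw⟩
  have hfin := gordon_of_finite (m := m) hε htf ht0 ht1
  have h1 : ∫ x, sSup ((fun v => ε * ‖sketch x v‖) '' T)
        ∂(stdGaussian (EuclideanSpace ℝ (Fin m × Fin n))) ≤
      ∫ x, sSup ((fun v => ε * ‖sketch x v‖) '' t)
        ∂(stdGaussian (EuclideanSpace ℝ (Fin m × Fin n))) + δ * B := by
    rw [← integral_const_mul, ← integral_add
      (lipschitzWith_sSup_norm_sketch hε ht0 ht1).integrable_stdGaussian
      (hLN.integrable_stdGaussian.const_mul δ)]
    refine integral_mono (lipschitzWith_sSup_norm_sketch hε hT0 hT).integrable_stdGaussian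
      ((lipschitzWith_sSup_norm_sketch hε ht0 ht1).integrable_stdGaussian.add
        (hLN.integrable_stdGaussian.const_mul δ)) fun x => csSup_le (hT0.image _) ?_
    rintro _ ⟨v, hv, rfl⟩
    obtain ⟨w, hw, hvw⟩ := hcov v hv
    have b1 : ε * ‖sketch x w‖ ≤ sSup ((fun v => ε * ‖sketch x v‖) '' t) :=
      le_csSup (bddAbove_mul_norm_sketch hε ht1 x) ⟨w, hw, rfl⟩
    have b2 : ε * ‖sketch x v‖ - ε * ‖sketch x w‖ ≤ δ * ‖x‖ := by
      rw [← mul_sub]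
      refine (le_abs_self _).trans ?_
      rw [abs_mul, hε, one_mul]
      refine (abs_norm_sub_norm_le _ _).trans ?_
      rw [← sketch_sub_right, mul_comm]
      refine (norm_sketch_le _ _).trans ?_
      rw [← dist_eq_norm]
      gcongr
    dsimp only
    linarith
  have h2 : ∫ h, sSup ((fun v => ε * inner ℝ v h) '' t) ∂(stdGaussian (Vec n)) ≤
      ∫ h, sSup ((fun v => ε * inner ℝ v h) '' T) ∂(stdGaussian (Vec n)) :=
    integral_mono (lipschitzWith_sSup_inner hε ht0 ht1).integrable_stdGaussian
      (lipschitzWith_sSup_inner hε hT0 hT).integrable_stdGaussian fun x =>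
        csSup_le_csSup (bddAbove_mul_inner hε hT x) (ht0.image _) (Set.image_mono htT)
  have h3 : δ * B ≤ η := by
    simp only [δ]
    rw [div_mul_eq_mul_div, div_le_iff₀ (by positivity)]
    nlinarith
  linarith

/-- The tail bound for the extreme values of `‖S v‖` over a set of unit vectors. -/
theorem stdGaussian_real_sketch_le_exp (hε : |ε| = 1) {T : Set (Vec n)} (hT0 : T.Nonempty)
    (hT : ∀ v ∈ T, ‖v‖ = 1) {θ : ℝ} (hθ : 0 ≤ θ) {w : ℝ}
    (hw : ∫ h, sSup ((fun v => ε * inner ℝ v h) '' T) ∂(stdGaussian (Vec n)) ≤ w) :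
    (stdGaussian (EuclideanSpace ℝ (Fin m × Fin n))).real
      {x | ∃ v ∈ T, ε * (∫ g, ‖g‖ ∂(stdGaussian (Vec m))) + w + θ < ε * ‖sketch x v‖} ≤
      Real.exp (-θ ^ 2 / 2) := by
  refine le_trans (measureReal_mono ?_)
    (stdGaussian_real_ge_le_exp (lipschitzWith_sSup_norm_sketch (m := m) hε hT0 hT) hθ)
  rintro x ⟨v, hv, hlt⟩
  have h1 : ε * ‖sketch x v‖ ≤ sSup ((fun v => ε * ‖sketch x v‖) '' T) :=
    le_csSup (bddAbove_mul_norm_sketch hε hT x) ⟨v, hv, rfl⟩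
  have h2 := gordon (m := m) hε hT0 hT
  rw [Set.mem_ofPred_eq]
  linarith

end Gordon

/-! ### The mean of the norm of a Gaussian vector -/

lemma gaussianPi_eq_withDensity (κ : Type*) [Fintype κ] :
    gaussianPi κ = (volume : Measure (κ → ℝ)).withDensity
      fun x => ENNReal.ofReal (∏ k, gaussianPDFReal 0 1 (x k)) := by
  refine Measure.pi_eq fun s hs => ?_
  have hnn : ∀ x : κ → ℝ, 0 ≤ ∏ k, gaussianPDFReal 0 1 (x k) := fun x =>
    Finset.prod_nonneg fun k _ => gaussianPDFReal_nonneg 0 1 _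
  have hi : Integrable (fun x : κ → ℝ => ∏ k, gaussianPDFReal 0 1 (x k)) :=
    Integrable.fintype_prod fun _ => integrable_gaussianPDFReal 0 1
  rw [withDensity_apply _ (MeasurableSet.univ_pi hs),
    ← ofReal_integral_eq_lintegral_ofReal hi.restrict (Filter.Eventually.of_forall hnn),
    volume_pi, Measure.restrict_pi_pi,
    integral_fintype_prod_eq_prod (fun _ : κ => gaussianPDFReal 0 1),
    ENNReal.ofReal_prod_of_nonneg fun k _ => integral_nonneg fun x => gaussianPDFReal_nonneg 0 1 x]
  exact Finset.prod_congr rfl fun k _ => (gaussianReal_apply_eq_integral 0 one_ne_zero _).symm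

lemma integral_stdGaussian_eq_integral_volume {m : ℕ} (f : Vec m → ℝ) (hf : Continuous f) :
    ∫ x, f x ∂(stdGaussian (Vec m)) =
      ∫ y : Vec m, (√(2 * Real.pi))⁻¹ ^ m * (Real.exp (-‖y‖ ^ 2 / 2) * f y) := by
  rw [← map_pi_eq_stdGaussian, integral_map (Measurable.aemeasurable (by fun_prop))
    hf.aestronglyMeasurable]
  change ∫ x, f (WithLp.toLp 2 x) ∂(gaussianPi (Fin m)) = _
  have hmeas : Measurable fun x : Fin m → ℝ =>
      ENNReal.ofReal (∏ k, gaussianPDFReal 0 1 (x k)) := by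
    refine ENNReal.measurable_ofReal.comp (Finset.measurable_prod _ fun k _ => ?_)
    exact (measurable_gaussianPDFReal 0 1).comp (measurable_pi_apply k)
  rw [gaussianPi_eq_withDensity, integral_withDensity_eq_integral_toReal_smul hmeas
    (Filter.Eventually.of_forall fun x => ENNReal.ofReal_lt_top),
    ← (PiLp.volume_preserving_toLp (Fin m)).integral_comp
      (MeasurableEquiv.toLp 2 (Fin m → ℝ)).measurableEmbedding]
  refine integral_congr_ae (Filter.Eventually.of_forall fun x => ?_)
  dsimp only
  rw [ENNReal.toReal_ofReal (Finset.prod_nonneg fun k _ => gaussianPDFReal_nonneg 0 1 _),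
    smul_eq_mul, ← mul_assoc]
  congr 1
  simp only [gaussianPDFReal, NNReal.coe_one, mul_one, sub_zero, Finset.prod_mul_distrib,
    Finset.prod_const, Finset.card_univ, Fintype.card_fin, ← Real.exp_sum]
  rw [EuclideanSpace.real_norm_sq_eq, ← Finset.sum_div, Finset.sum_neg_distrib]

/-- The constant K is left implicit because the radial function 1, whose Gaussian mean is 1,
determines it afterwards. The volume of the ball is never computed. -/
lemma integral_radial {m : ℕ} (hm : 0 < m) :
    ∃ K : ℝ, ∀ f : ℝ → ℝ, Continuous f → ∫ x, f ‖x‖ ∂(stdGaussian (Vec m)) =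
      K * ∫ y in Set.Ioi (0 : ℝ), y ^ (m - 1) * (Real.exp (-y ^ 2 / 2) * f y) := by
  have : Nonempty (Fin m) := ⟨⟨0, hm⟩⟩
  refine ⟨(√(2 * Real.pi))⁻¹ ^ m * (m * volume.real (Metric.ball (0 : Vec m) 1)), fun f hf => ?_⟩
  rw [integral_stdGaussian_eq_integral_volume (fun x => f ‖x‖) (by fun_prop), integral_const_mul,
    integral_fun_norm_addHaar volume fun y => Real.exp (-y ^ 2 / 2) * f y]
  simp only [finrank_euclideanSpace, Fintype.card_fin, nsmul_eq_mul, smul_eq_mul]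
  ring

lemma integral_pow_mul_exp_neg_sq (k : ℕ) :
    ∫ y in Set.Ioi (0 : ℝ), y ^ k * Real.exp (-y ^ 2 / 2) =
      (1 / 2) ^ (-((k : ℝ) + 1) / 2) * (1 / 2) * Real.Gamma (((k : ℝ) + 1) / 2) := by
  rw [← integral_rpow_mul_exp_neg_mul_rpow (p := 2) (q := k) (b := 1 / 2) (by norm_num)
    (by have : (0 : ℝ) ≤ k := k.cast_nonneg
        linarith) (by norm_num)]
  refine setIntegral_congr_fun measurableSet_Ioi fun y hy => ?_
  rw [Real.rpow_natCast, Real.rpow_two]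
  congr 2
  ring

/-- `b_m` is the mean of the norm of a standard Gaussian vector in `ℝᵐ`. -/
theorem integral_norm_stdGaussian {m : ℕ} (hm : 0 < m) :
    ∫ g, ‖g‖ ∂(stdGaussian (Vec m)) = gaussianNormMean m := by
  obtain ⟨K, hK⟩ := integral_radial hm
  have h1 := hK (fun _ => 1) continuous_const
  have h2 := hK (fun y => y) continuous_id
  have hm1 : ((m - 1 : ℕ) : ℝ) + 1 = m := by
    rw [← Nat.cast_add_one, Nat.sub_add_cancel hm]
  have e : ∀ y : ℝ, y ^ (m - 1) * (Real.exp (-y ^ 2 / 2) * y) = y ^ m * Real.exp (-y ^ 2 / 2) := by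
    intro y
    conv_rhs => rw [← Nat.sub_add_cancel hm, pow_succ]
    ring
  simp only [mul_one, integral_const, probReal_univ, smul_eq_mul, integral_pow_mul_exp_neg_sq,
    e, hm1] at h1 h2
  rw [h2, gaussianNormMean]
  have hG : Real.Gamma ((m : ℝ) / 2) ≠ 0 := (Real.Gamma_pos_of_pos (by positivity)).ne'
  have hsplit : ((1 : ℝ) / 2) ^ (-((m : ℝ) + 1) / 2) = (1 / 2) ^ (-(m : ℝ) / 2) * √2 := by
    rw [Real.sqrt_eq_rpow, show (2 : ℝ) ^ ((1 : ℝ) / 2) = (1 / 2) ^ (-(1 : ℝ) / 2) by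
      rw [one_div, Real.inv_rpow (by norm_num), ← Real.rpow_neg (by norm_num)]
      norm_num, ← Real.rpow_add (by norm_num)]
    congr 1
    ring
  rw [hsplit, eq_div_iff hG]
  linear_combination (-√2 * Real.Gamma (((m : ℝ) + 1) / 2)) * h1

lemma gaussianNormMean_pos {m : ℕ} (hm : 0 < m) : 0 < gaussianNormMean m := by
  have := Real.Gamma_pos_of_pos (s := ((m : ℝ) + 1) / 2) (by positivity)
  have := Real.Gamma_pos_of_pos (s := (m : ℝ) / 2) (by positivity)
  unfold gaussianNormMean
  positivity

/-- Log-convexity of Γ at the midpoint of x + 1/2 and x + 3/2, with x = m/2, gives (xΓ(x))² ≤ (x +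
1/2)Γ(x + 1/2)². Hence b_m² ≥ 2x²/(x + 1/2), which is at least x because x ≥ 1/2. -/
lemma half_le_sq_gaussianNormMean {m : ℕ} (hm : 0 < m) : (m : ℝ) / 2 ≤ gaussianNormMean m ^ 2 := by
  have hm' : (1 : ℝ) ≤ m := by exact_mod_cast hm
  set x : ℝ := (m : ℝ) / 2 with hx
  have hx0 : 0 < x := by positivity
  have hG := Real.Gamma_pos_of_pos hx0
  have hG1 := Real.Gamma_pos_of_pos (s := x + 1 / 2) (by positivity)
  have h := Real.Gamma_mul_add_mul_le_rpow_Gamma_mul_rpow_Gamma (s := x + 1 / 2)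
    (t := x + 1 / 2 + 1) (a := 1 / 2) (b := 1 / 2) (by positivity) (by positivity) (by norm_num)
    (by norm_num) (by norm_num)
  rw [Real.Gamma_add_one (by positivity), show 1 / 2 * (x + 1 / 2) + 1 / 2 * (x + 1 / 2 + 1) = x + 1
    by ring, Real.Gamma_add_one hx0.ne', ← Real.sqrt_eq_rpow, ← Real.sqrt_eq_rpow,
    ← Real.sqrt_mul hG1.le] at h
  have h2 : (x * Real.Gamma x) ^ 2 ≤ (x + 1 / 2) * Real.Gamma (x + 1 / 2) ^ 2 := by
    calc _ ≤ √(Real.Gamma (x + 1 / 2) * ((x + 1 / 2) * Real.Gamma (x + 1 / 2))) ^ 2 := by gcongr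
      _ = _ := by rw [Real.sq_sqrt (by positivity)]; ring
  have hb : gaussianNormMean m = √2 * Real.Gamma (x + 1 / 2) / Real.Gamma x := by
    unfold gaussianNormMean
    rw [add_div]
  rw [hb, div_pow, mul_pow, Real.sq_sqrt (by norm_num), le_div_iff₀ (by positivity)]
  have h3 : x + 1 / 2 ≤ 2 * x := by linarith
  have h4 : x * (x * Real.Gamma x ^ 2) ≤ x * (2 * Real.Gamma (x + 1 / 2) ^ 2) := by
    nlinarith [mul_le_mul_of_nonneg_right h3 (sq_nonneg (Real.Gamma (x + 1 / 2)))]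
  exact le_of_mul_le_mul_left h4 hx0

/-! ### Gaussian widths -/

/-- The standard Gaussian is invariant under h ↦ -h. This identifies the width term of Gordon's
inequality at ε = -1 with W. -/
lemma gaussianWidth_eq_integral_neg {n : ℕ} (T : Set (Vec n)) :
    ∫ h, sSup ((fun v => (-1) * inner ℝ v h) '' T) ∂(stdGaussian (Vec n)) = gaussianWidth T := by
  have hmap := stdGaussian_map (LinearIsometryEquiv.neg ℝ (E := Vec n))
  rw [gaussianWidth]
  conv_rhs => rw [← hmap]
  have hme : MeasurableEmbedding (LinearIsometryEquiv.neg ℝ (E := Vec n)) :=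
    (LinearIsometryEquiv.neg ℝ (E := Vec n)).toHomeomorph.measurableEmbedding
  rw [hme.integral_map]
  simp

lemma integral_inner_sq_stdGaussian {n : ℕ} {v : Vec n} (hv : ‖v‖ = 1) :
    ∫ h, (inner ℝ v h) ^ 2 ∂(stdGaussian (Vec n)) = 1 := by
  have h := variance_dual_stdGaussian (E := Vec n) (innerSL ℝ v)
  rw [variance_of_integral_eq_zero (by fun_prop) (integral_strongDual_stdGaussian _),
    innerSL_apply_norm, hv, one_pow] at h
  simpa using h

/-- The Gaussian width of the unit sphere of the range of a linear map from `ℝᵈ` is at most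
`√d`. -/
lemma integral_sSup_inner_range_le {n d : ℕ} (f : Vec d →ₗ[ℝ] Vec n)
    (hT0 : (Set.range f ∩ Metric.sphere 0 1).Nonempty) (hd : 0 < d) :
    ∫ h, sSup ((fun v => 1 * inner ℝ v h) '' (Set.range f ∩ Metric.sphere 0 1))
      ∂(stdGaussian (Vec n)) ≤ √(d : ℝ) := by
  let b := stdOrthonormalBasis ℝ (LinearMap.range f)
  have hk : (Module.finrank ℝ (LinearMap.range f) : ℝ) ≤ d := by
    have := LinearMap.finrank_range_le f
    rw [finrank_euclideanSpace, Fintype.card_fin] at this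
    exact_mod_cast this
  have hb1 : ∀ i, ‖(b i : Vec n)‖ = 1 := fun i => b.orthonormal.1 i
  have hd0 : 0 < √(d : ℝ) := Real.sqrt_pos.2 (by exact_mod_cast hd)
  have hdd : √(d : ℝ) * √(d : ℝ) = d := Real.mul_self_sqrt d.cast_nonneg
  -- The supremum is at most the norm of the projection of h on the range. The bound t ≤ t²/(2√d) +
  -- √d/2 linearizes the square root, so only the mean of the squared norm, the rank, is needed.
  have hpt : ∀ h : Vec n, sSup ((fun v => 1 * inner ℝ v h) '' (Set.range f ∩ Metric.sphere 0 1)) ≤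
      (∑ i, (inner ℝ (b i : Vec n) h) ^ 2) / (2 * √(d : ℝ)) + √(d : ℝ) / 2 := by
    intro h
    refine csSup_le (hT0.image _) ?_
    rintro _ ⟨v, ⟨⟨u, rfl⟩, hv⟩, rfl⟩
    have hv1 : ‖f u‖ = 1 := by simpa using hv
    set w : LinearMap.range f := ⟨f u, u, rfl⟩
    have hw : f u = ∑ i, inner ℝ (b i) w • (b i : Vec n) := by
      have := congrArg (Subtype.val) (b.sum_repr' w)
      rw [← Submodule.coe_subtype, map_sum] at this
      simpa using this.symm
    have hw1 : ∑ i, (inner ℝ (b i) w) ^ 2 = 1 := by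
      have := b.sum_sq_norm_inner_right w
      have hn : ‖w‖ = 1 := hv1
      rw [hn] at this
      simpa using this
    set Q := ∑ i, (inner ℝ (b i : Vec n) h) ^ 2 with hQ
    have hcs : (inner ℝ (f u) h) ^ 2 ≤ Q := by
      rw [hw, sum_inner]
      simp only [real_inner_smul_left]
      have := Finset.sum_mul_sq_le_sq_mul_sq Finset.univ (fun i => inner ℝ (b i) w)
        (fun i => inner ℝ (b i : Vec n) h)
      rwa [hw1, one_mul] at this
    simp only [one_mul]
    have h1 : Q / (2 * √(d : ℝ)) + √(d : ℝ) / 2 = (Q + √(d : ℝ) * √(d : ℝ)) / (2 * √(d : ℝ)) := by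
      field_simp
    rw [h1, le_div_iff₀ (by positivity)]
    nlinarith [sq_nonneg (inner ℝ (f u) h - √(d : ℝ))]
  have hint : ∀ i, Integrable (fun h => (inner ℝ (b i : Vec n) h) ^ 2) (stdGaussian (Vec n)) := by
    intro i
    refine ExpGrowth.integrable_stdGaussian ?_ (by fun_prop)
    refine (ExpGrowth.norm.mul ExpGrowth.norm).of_le fun x => ?_
    have := abs_real_inner_le_norm (b i : Vec n) x
    rw [hb1 i, one_mul] at this
    rw [abs_pow, abs_mul, abs_norm, sq]
    gcongr
  have hint2 : Integrable (fun h => (∑ i, (inner ℝ (b i : Vec n) h) ^ 2) / (2 * √(d : ℝ)) +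
      √(d : ℝ) / 2) (stdGaussian (Vec n)) :=
    ((integrable_finsetSum _ fun i _ => hint i).div_const _).add (integrable_const _)
  calc _ ≤ ∫ h, ((∑ i, (inner ℝ (b i : Vec n) h) ^ 2) / (2 * √(d : ℝ)) + √(d : ℝ) / 2)
        ∂(stdGaussian (Vec n)) :=
        integral_mono (lipschitzWith_sSup_inner abs_one hT0 fun v hv => by
          simpa using hv.2).integrable_stdGaussian hint2 hpt
    _ = (Module.finrank ℝ (LinearMap.range f) : ℝ) / (2 * √(d : ℝ)) + √(d : ℝ) / 2 := by
        rw [integral_add ((integrable_finsetSum _ fun i _ => hint i).div_const _)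
          (integrable_const _), integral_div, integral_finsetSum _ fun i _ => hint i]
        simp [integral_inner_sq_stdGaussian (hb1 _)]
    _ ≤ d / (2 * √(d : ℝ)) + √(d : ℝ) / 2 := by gcongr
    _ = √(d : ℝ) := by
        rw [div_add_div _ _ (by positivity) (by norm_num), div_eq_iff (by positivity)]
        linarith

/-! ### The largest singular value -/

/-- In an eigenbasis of T*T the form ‖T u‖² is diagonal with the squared singular values as entries,
and these are largest at index 0. -/
lemma norm_apply_le_singularValues_zero {E F : Type*} [NormedAddCommGroup E]
    [InnerProductSpace ℝ E] [FiniteDimensional ℝ E] [NormedAddCommGroup F] [InnerProductSpace ℝ F]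
    [FiniteDimensional ℝ F] (T : E →ₗ[ℝ] F) (u : E) : ‖T u‖ ≤ T.singularValues 0 * ‖u‖ := by
  have hT := T.isSymmetric_adjoint_comp_self
  let b := hT.eigenvectorBasis rfl
  refine le_of_sq_le_sq ?_ (mul_nonneg (T.singularValues_nonneg 0) (norm_nonneg u))
  have h1 : ‖T u‖ ^ 2 = ∑ i, hT.eigenvalues rfl i * (inner ℝ (b i) u) ^ 2 := by
    rw [← real_inner_self_eq_norm_sq, ← LinearMap.adjoint_inner_left,
      ← b.sum_inner_mul_inner]
    refine Finset.sum_congr rfl fun i _ => ?_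
    have h := hT u (b i)
    rw [hT.apply_eigenvectorBasis rfl i] at h
    simp only [LinearMap.comp_apply, real_inner_smul_right] at h
    rw [h, real_inner_comm u]
    simp only [b, RCLike.ofReal_real_eq_id, id]
    ring
  have h2 : ‖u‖ ^ 2 = ∑ i, (inner ℝ (b i) u) ^ 2 := by
    have := b.sum_sq_norm_inner_right u
    rw [← this]
    simp
  rw [h1, mul_pow, h2, Finset.mul_sum]
  refine Finset.sum_le_sum fun i _ => mul_le_mul_of_nonneg_right ?_ (sq_nonneg _)
  rw [← T.sq_singularValues_fin rfl i]
  exact pow_le_pow_left₀ (T.singularValues_nonneg _) (T.singularValues_antitone (Nat.zero_le _)) 2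

lemma inner_toEuclideanLin_transpose_mul {k d : ℕ} (B : Matrix (Fin k) (Fin d) ℝ) (v u : Vec d) :
    inner ℝ v (Matrix.toEuclideanLin (B.transpose * B) u) =
      inner ℝ (Matrix.toEuclideanLin B v) (Matrix.toEuclideanLin B u) := by
  have h := Matrix.toEuclideanLin_conjTranspose_eq_adjoint B
  rw [Matrix.conjTranspose_eq_transpose_of_trivial] at h
  rw [Matrix.toLpLin_mul_same, LinearMap.comp_apply, h, LinearMap.adjoint_inner_right]

lemma norm_sq_le_lipschitzConst {n d : ℕ} (A : Matrix (Fin n) (Fin d) ℝ) (u : Vec d) :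
    ‖Matrix.toEuclideanLin A u‖ ^ 2 ≤ lipschitzConst A * ‖u‖ ^ 2 := by
  rw [← real_inner_self_eq_norm_sq, ← inner_toEuclideanLin_transpose_mul]
  refine (real_inner_le_norm _ _).trans ?_
  have := mul_le_mul_of_nonneg_left (norm_apply_le_singularValues_zero
    (Matrix.toEuclideanLin (A.transpose * A)) u) (norm_nonneg u)
  unfold lipschitzConst
  linarith

/-! ### The descent cone -/

lemma isCone_descentCone {d : ℕ} (K : Set (Vec d)) (x : Vec d) : IsCone (descentCone K x) :=
  fun t ht z hz C hC => hC.2.1 t ht z (hz C hC)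

lemma zero_mem_descentCone {d : ℕ} {K : Set (Vec d)} {x : Vec d} (hx : x ∈ K) :
    (0 : Vec d) ∈ descentCone K x := fun C hC => by
  simpa using hC.2.2 x hx

/-- If C contained no nonzero vector, every positive constant would be admissible and none would be
greatest. The nonzero vector found here yields d > 0, μ ≤ L and a nonempty A C ∩ 𝕊. -/
lemma IsConeStrongConvexityConst.exists_ne_zero {n d : ℕ} {A : Matrix (Fin n) (Fin d) ℝ}
    {C : Set (Vec d)} {μ : ℝ} (hμ : IsConeStrongConvexityConst A C μ) : ∃ z ∈ C, z ≠ 0 := by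
  by_contra! h
  have : μ + 1 ≤ μ := hμ.2 ⟨by linarith [hμ.1.1], fun z hz => by simp [h z hz]⟩
  linarith

/-! ### The contraction factor -/

/-- If `S` is bounded below by `β` on `A C ∩ 𝕊` and above by `γ` on `range A ∩ 𝕊`, then the step
size `1 / (L γ²)` contracts. -/
lemma contractionFactor_le {m n d : ℕ} {A : Matrix (Fin n) (Fin d) ℝ} {C : Set (Vec d)} {μ : ℝ}
    (hC : IsCone C) (hμ : IsConeStrongConvexityConst A C μ) (h0 : (0 : Vec d) ∈ C)
    (S : Matrix (Fin m) (Fin n) ℝ) {L β γ : ℝ}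
    (hL : ∀ u, ‖Matrix.toEuclideanLin A u‖ ^ 2 ≤ L * ‖u‖ ^ 2) (hβ : 0 ≤ β) (hγ : 0 < γ)
    (h1 : ∀ v ∈ (Matrix.toEuclideanLin A '' C) ∩ Metric.sphere 0 1,
      β ≤ ‖Matrix.toEuclideanLin S v‖)
    (h2 : ∀ v ∈ Set.range (Matrix.toEuclideanLin A) ∩ Metric.sphere 0 1,
      ‖Matrix.toEuclideanLin S v‖ ≤ γ) :
    contractionFactor C (1 / (L * γ ^ 2)) (S * A) ≤ 1 - μ / L * (β ^ 2 / γ ^ 2) := by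
  have hμ0 := hμ.1.1
  have hμC := hμ.1.2
  obtain ⟨z, hzC, hz⟩ := hμ.exists_ne_zero
  have hzn : 0 < ‖z‖ ^ 2 := by positivity
  have hμL : μ ≤ L := le_of_mul_le_mul_right ((hμC z hzC).trans (hL z)) hzn
  have hL0 : 0 < L := hμ0.trans_le hμL
  have hAz : Matrix.toEuclideanLin A z ≠ 0 := fun h => by
    have := hμC z hzC
    rw [h, norm_zero] at this
    nlinarith
  have unit : ∀ u, Matrix.toEuclideanLin A u ≠ 0 →
      Matrix.toEuclideanLin A (‖Matrix.toEuclideanLin A u‖⁻¹ • u) ∈ Metric.sphere (0 : Vec n) 1 := by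
    intro u hu
    have := norm_ne_zero_iff.2 hu
    rw [mem_sphere_zero_iff_norm, map_smul, norm_smul, norm_inv, norm_norm, inv_mul_cancel₀ this]
  have scale : ∀ u, Matrix.toEuclideanLin A u ≠ 0 →
      ‖Matrix.toEuclideanLin S (Matrix.toEuclideanLin A u)‖ = ‖Matrix.toEuclideanLin A u‖ *
        ‖Matrix.toEuclideanLin S
          (Matrix.toEuclideanLin A (‖Matrix.toEuclideanLin A u‖⁻¹ • u))‖ := by
    intro u hu
    have := norm_ne_zero_iff.2 hu
    rw [map_smul, map_smul, norm_smul, norm_inv, norm_norm, mul_inv_cancel_left₀ this]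
  have memC : ∀ u ∈ C, ‖Matrix.toEuclideanLin A u‖⁻¹ • u ∈ C := fun u hu =>
    hC _ (inv_nonneg.2 (norm_nonneg _)) u hu
  -- This bound is needed on all of ℝᵈ, since it is used at differences u - v that may leave C.
  -- Hence the width of range A, and so √d, enters γ.
  have up : ∀ u, ‖Matrix.toEuclideanLin S (Matrix.toEuclideanLin A u)‖ ^ 2 ≤
      L * γ ^ 2 * ‖u‖ ^ 2 := by
    intro u
    by_cases hu : Matrix.toEuclideanLin A u = 0
    · rw [hu, map_zero, norm_zero, zero_pow two_ne_zero]
      positivity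
    · rw [scale u hu, mul_pow]
      have h := h2 _ ⟨⟨_, rfl⟩, unit u hu⟩
      calc _ ≤ ‖Matrix.toEuclideanLin A u‖ ^ 2 * γ ^ 2 := by gcongr
        _ ≤ L * ‖u‖ ^ 2 * γ ^ 2 := by gcongr; exact hL u
        _ = _ := by ring
  have low : ∀ u ∈ C, μ * β ^ 2 * ‖u‖ ^ 2 ≤
      ‖Matrix.toEuclideanLin S (Matrix.toEuclideanLin A u)‖ ^ 2 := by
    intro u hu
    by_cases hAu : Matrix.toEuclideanLin A u = 0
    · have h := hμC u hu
      rw [hAu, norm_zero] at h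
      rw [hAu, map_zero, norm_zero]
      nlinarith [sq_nonneg β]
    · rw [scale u hAu, mul_pow]
      have h := h1 _ ⟨⟨_, memC u hu, rfl⟩, unit u hAu⟩
      calc μ * β ^ 2 * ‖u‖ ^ 2 = μ * ‖u‖ ^ 2 * β ^ 2 := by ring
        _ ≤ ‖Matrix.toEuclideanLin A u‖ ^ 2 * β ^ 2 := by gcongr; exact hμC u hu
        _ ≤ _ := by gcongr
  have hβγ : β ≤ γ :=
    (h1 _ ⟨⟨_, memC z hzC, rfl⟩, unit z hAz⟩).trans (h2 _ ⟨⟨_, rfl⟩, unit z hAz⟩)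
  set B := S * A with hB
  have hBu : ∀ u, Matrix.toEuclideanLin B u =
      Matrix.toEuclideanLin S (Matrix.toEuclideanLin A u) := fun u => by
    rw [hB, Matrix.toLpLin_mul_same, LinearMap.comp_apply]
  set η := 1 / (L * γ ^ 2) with hη
  have hη0 : 0 < η := by positivity
  have hηL : η * (L * γ ^ 2) = 1 := by rw [hη]; field_simp
  have hform : ∀ v u, inner ℝ v (Matrix.toEuclideanLin (1 - η • (B.transpose * B)) u) =
      inner ℝ v u - η * inner ℝ (Matrix.toEuclideanLin B v) (Matrix.toEuclideanLin B u) := by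
    intro v u
    rw [map_sub, map_smul, LinearMap.sub_apply, LinearMap.smul_apply, inner_sub_right,
      inner_smul_right, inner_toEuclideanLin_transpose_mul, Matrix.toLpLin_one,
      LinearMap.id_apply]
  have hpos : ∀ u, 0 ≤ ‖u‖ ^ 2 - η * ‖Matrix.toEuclideanLin B u‖ ^ 2 := by
    intro u
    have := mul_le_mul_of_nonneg_left (up u) hη0.le
    rw [← hBu, ← mul_assoc, hηL, one_mul] at this
    linarith
  have hrate : μ / L * (β ^ 2 / γ ^ 2) = η * (μ * β ^ 2) := by
    rw [hη]; field_simp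
  -- The rate is at most 1, so 1 - rate is nonnegative and ‖u‖² may be replaced by its bound 1 on
  -- the ball.
  have hrate1 : μ / L * (β ^ 2 / γ ^ 2) ≤ 1 := by
    have h3 : μ / L ≤ 1 := (div_le_one hL0).2 hμL
    have h4 : β ^ 2 / γ ^ 2 ≤ 1 := (div_le_one (by positivity)).2 (by gcongr)
    exact mul_le_one₀ h3 (by positivity) h4
  have hquad : ∀ u ∈ C ∩ Metric.closedBall 0 1,
      ‖u‖ ^ 2 - η * ‖Matrix.toEuclideanLin B u‖ ^ 2 ≤ 1 - μ / L * (β ^ 2 / γ ^ 2) := by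
    rintro u ⟨huC, hu⟩
    rw [mem_closedBall_zero_iff] at hu
    have h5 := mul_le_mul_of_nonneg_left (low u huC) hη0.le
    rw [← hBu] at h5
    have h6 : ‖u‖ ^ 2 ≤ 1 := pow_le_one₀ (norm_nonneg u) hu
    have h7 := mul_le_mul_of_nonneg_left h6 (sub_nonneg.2 hrate1)
    rw [hrate] at h7 ⊢
    linarith
  refine csSup_le ⟨_, 0, ⟨h0, by simp⟩, 0, ⟨h0, by simp⟩, rfl⟩ ?_
  rintro _ ⟨u, hu, v, hv, rfl⟩
  rw [hform]
  -- Expanding q(u - v) ≥ 0 bounds the bilinear form by the average of q(u) and q(v).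
  have h8 := hpos (u - v)
  rw [map_sub, norm_sub_sq_real, norm_sub_sq_real, real_inner_comm, real_inner_comm
    (Matrix.toEuclideanLin B v)] at h8
  have h9 := hquad u hu
  have h10 := hquad v hv
  linarith

/-! ### The random sketch -/

lemma IsGaussianSketch.map_eq {Ω : Type*} [MeasurableSpace Ω] {P : Measure Ω}
    [IsProbabilityMeasure P] {m n : ℕ} {S : Ω → Matrix (Fin m) (Fin n) ℝ}
    (hS : IsGaussianSketch P S) :
    AEMeasurable (fun ω => (WithLp.toLp 2 fun p : Fin m × Fin n => S ω p.1 p.2 :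
      EuclideanSpace ℝ (Fin m × Fin n))) P ∧
    P.map (fun ω => (WithLp.toLp 2 fun p : Fin m × Fin n => S ω p.1 p.2 :
      EuclideanSpace ℝ (Fin m × Fin n))) = stdGaussian (EuclideanSpace ℝ (Fin m × Fin n)) := by
  have hm : ∀ p : Fin m × Fin n, AEMeasurable (fun ω => S ω p.1 p.2) P := fun p =>
    (hS.1 p.1 p.2).aemeasurable
  have hpi : AEMeasurable (fun ω (p : Fin m × Fin n) => S ω p.1 p.2) P :=
    aemeasurable_pi_lambda _ hm
  have hmap := (iIndepFun_iff_map_fun_eq_pi_map hm).1 hS.2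
  simp only [fun p : Fin m × Fin n => (hS.1 p.1 p.2).map_eq] at hmap
  have hto : Measurable (WithLp.toLp 2 : (Fin m × Fin n → ℝ) → _) :=
    (PiLp.continuous_toLp 2 _).measurable
  refine ⟨hto.comp_aemeasurable hpi, ?_⟩
  rw [← map_pi_eq_stdGaussian, ← hmap, AEMeasurable.map_map_of_aemeasurable hto.aemeasurable hpi]
  rfl

/-- A union bound phrased with outer measures: neither the bad sets nor the good event has to be
measurable, since the measure of a preimage never exceeds the pushforward measure of the set. -/
lemma one_sub_le_real_of_bad {Ω E : Type*} [MeasurableSpace Ω] [MeasurableSpace E] {P : Measure Ω}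
    [IsProbabilityMeasure P] {X : Ω → E} {ν : Measure E} [IsFiniteMeasure ν]
    (hX : AEMeasurable X P) (hν : P.map X = ν) {b₁ b₂ : Set E} {q : ℝ} (h₁ : ν.real b₁ ≤ q)
    (h₂ : ν.real b₂ ≤ q) {G : Set Ω} (hG : ∀ ω, X ω ∉ b₁ → X ω ∉ b₂ → ω ∈ G) :
    1 - 2 * q ≤ P.real G := by
  have pull : ∀ b : Set E, P.real (X ⁻¹' b) ≤ ν.real b := fun b => by
    refine ENNReal.toReal_mono (measure_ne_top ν b) ?_
    rw [← hν]
    exact Measure.le_map_apply hX b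
  have hcov : (Set.univ : Set Ω) ⊆ G ∪ (X ⁻¹' b₁ ∪ X ⁻¹' b₂) := fun ω _ => by
    by_contra h
    simp only [Set.mem_union, Set.mem_preimage, not_or] at h
    exact h.1 (hG ω h.2.1 h.2.2)
  have h3 : (1 : ℝ) ≤ P.real (G ∪ (X ⁻¹' b₁ ∪ X ⁻¹' b₂)) := by
    rw [← probReal_univ (μ := P)]
    exact measureReal_mono hcov
  have h4 := measureReal_union_le (μ := P) G (X ⁻¹' b₁ ∪ X ⁻¹' b₂)
  have h5 := measureReal_union_le (μ := P) (X ⁻¹' b₁) (X ⁻¹' b₂)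
  have h6 := pull b₁
  have h7 := pull b₂
  linarith

/-- The high-probability bound on the contraction factor at the conservative step size. -/
theorem one_sub_le_real_contractionFactor_le {n d m : ℕ} (hm : 0 < m)
    {A : Matrix (Fin n) (Fin d) ℝ} {C : Set (Vec d)} {μ : ℝ} (hC : IsCone C) (h0 : (0 : Vec d) ∈ C)
    (hμ : IsConeStrongConvexityConst A C μ) {θ : ℝ} (hθ : 0 ≤ θ) {Ω : Type*} [MeasurableSpace Ω]
    {P : Measure Ω} [IsProbabilityMeasure P] {S : Ω → Matrix (Fin m) (Fin n) ℝ}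
    (hS : IsGaussianSketch P S) (hW : coneWidth A C + θ ≤ gaussianNormMean m) :
    1 - 2 * Real.exp (-θ ^ 2 / 2) ≤
      P.real {ω | contractionFactor C (conservativeStep A m θ) (S ω * A) ≤
        1 - μ / lipschitzConst A * ((gaussianNormMean m - coneWidth A C - θ) ^ 2 /
          (gaussianNormMean m + √(d : ℝ) + θ) ^ 2)} := by
  obtain ⟨z, hzC, hz⟩ := hμ.exists_ne_zero
  have hd : 0 < d := by
    rcases Nat.eq_zero_or_pos d with rfl | h
    · exact absurd (Subsingleton.elim z 0) hz
    · exact h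
  have hAz : Matrix.toEuclideanLin A z ≠ 0 := fun h => by
    have h1 := hμ.1.2 z hzC
    have h2 : 0 < ‖z‖ ^ 2 := by positivity
    rw [h, norm_zero] at h1
    nlinarith [mul_pos hμ.1.1 h2]
  have hAzn := norm_ne_zero_iff.2 hAz
  have hunit : Matrix.toEuclideanLin A (‖Matrix.toEuclideanLin A z‖⁻¹ • z) ∈
      Metric.sphere (0 : Vec n) 1 := by
    rw [mem_sphere_zero_iff_norm, map_smul, norm_smul, norm_inv, norm_norm, inv_mul_cancel₀ hAzn]
  have hT1 : (Matrix.toEuclideanLin A '' C ∩ Metric.sphere 0 1).Nonempty :=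
    ⟨_, ⟨_, hC _ (inv_nonneg.2 (norm_nonneg _)) z hzC, rfl⟩, hunit⟩
  have hT2 : (Set.range (Matrix.toEuclideanLin A) ∩ Metric.sphere 0 1).Nonempty :=
    ⟨_, ⟨_, rfl⟩, hunit⟩
  have hbad1 := stdGaussian_real_sketch_le_exp (m := m) (ε := -1) (by simp) hT1
    (fun v hv => by simpa using hv.2) hθ (gaussianWidth_eq_integral_neg _).le
  have hbad2 := stdGaussian_real_sketch_le_exp (m := m) (ε := 1) (by simp) hT2
    (fun v hv => by simpa using hv.2) hθ (integral_sSup_inner_range_le _ hT2 hd)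
  rw [integral_norm_stdGaussian hm] at hbad1 hbad2
  have hb := gaussianNormMean_pos hm
  refine one_sub_le_real_of_bad hS.map_eq.1 hS.map_eq.2 hbad1 hbad2 fun ω hω1 hω2 => ?_
  have hsk : ∀ v, sketch (WithLp.toLp 2 fun p : Fin m × Fin n => S ω p.1 p.2) v =
      Matrix.toEuclideanLin (S ω) v := fun v => rfl
  have hω1' : ∀ v ∈ Matrix.toEuclideanLin A '' C ∩ Metric.sphere 0 1,
      gaussianNormMean m - coneWidth A C - θ ≤ ‖Matrix.toEuclideanLin (S ω) v‖ := by
    intro v hv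
    by_contra! h
    refine hω1 ⟨v, hv, ?_⟩
    rw [hsk]
    unfold coneWidth at h
    linarith
  have hω2' : ∀ v ∈ Set.range (Matrix.toEuclideanLin A) ∩ Metric.sphere 0 1,
      ‖Matrix.toEuclideanLin (S ω) v‖ ≤ gaussianNormMean m + √(d : ℝ) + θ := by
    intro v hv
    by_contra! h
    refine hω2 ⟨v, hv, ?_⟩
    rw [hsk]
    linarith
  exact contractionFactor_le hC hμ h0 (S ω) (norm_sq_le_lipschitzConst A) (by linarith)
    (by positivity) hω1' hω2'

end SketchedPGD

end

/-! ### The main theorem. -/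

theorem lemma2 :
    ∃ c : ℝ, 0 < c ∧
      ∀ (n d m : ℕ) (_hm : 0 < m) (A : Matrix (Fin n) (Fin d) ℝ)
        (K : Set (SketchedPGD.Vec d)) (x : SketchedPGD.Vec d) (_hx : x ∈ K)
        (μ : ℝ)
        (_hμ : SketchedPGD.IsConeStrongConvexityConst A (SketchedPGD.descentCone K x) μ)
        (θ : ℝ) (_hθ : 0 ≤ θ)
        (Ω : Type*) [MeasurableSpace Ω] (P : Measure Ω) [IsProbabilityMeasure P]
        (S : Ω → Matrix (Fin m) (Fin n) ℝ) (_hS : SketchedPGD.IsGaussianSketch P S),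
        (SketchedPGD.coneWidth A (SketchedPGD.descentCone K x) + θ
              ≤ SketchedPGD.gaussianNormMean m →
          1 - 2 * Real.exp (-θ ^ 2 / 2) ≤
            P.real {ω | SketchedPGD.contractionFactor (SketchedPGD.descentCone K x)
                (SketchedPGD.conservativeStep A m θ) (S ω * A) ≤
              1 - μ / SketchedPGD.lipschitzConst A *
                ((SketchedPGD.gaussianNormMean m
                    - SketchedPGD.coneWidth A (SketchedPGD.descentCone K x) - θ) ^ 2 /
                  (SketchedPGD.gaussianNormMean m + √(d : ℝ) + θ) ^ 2)}) ∧
        (c * (SketchedPGD.coneWidth A (SketchedPGD.descentCone K x) + θ) ^ 2 ≤ (m : ℝ) →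
          1 - 2 * Real.exp (-θ ^ 2 / 2) ≤
            P.real {ω | SketchedPGD.contractionFactor (SketchedPGD.descentCone K x)
                (SketchedPGD.conservativeStep A m θ) (S ω * A) < 1}) := by
  -- If b_m ≤ W + θ, then m/2 ≤ b_m² ≤ (W + θ)² ≤ m/4, which is impossible for m > 0. Any constant
  -- above 2 would do, and the strict inequality W + θ < b_m makes the rate in (i) positive.
  refine ⟨4, by norm_num, fun n d m hm A K x hx μ hμ θ hθ Ω _ P _ S hS => ?_⟩
  have hC := SketchedPGD.isCone_descentCone K x
  have h0 := SketchedPGD.zero_mem_descentCone hx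
  have hbound := fun hW => SketchedPGD.one_sub_le_real_contractionFactor_le hm hC h0 hμ hθ hS hW
  refine ⟨hbound, fun hm4 => ?_⟩
  have hb := SketchedPGD.gaussianNormMean_pos hm
  have hb2 := SketchedPGD.half_le_sq_gaussianNormMean hm
  have hlt : SketchedPGD.coneWidth A (SketchedPGD.descentCone K x) + θ <
      SketchedPGD.gaussianNormMean m := by
    by_contra! h
    have h1 := pow_le_pow_left₀ hb.le h 2
    have h2 : (0 : ℝ) < m := by exact_mod_cast hm
    linarith
  refine (hbound hlt.le).trans (measureReal_mono fun ω hω => ?_)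
  rw [Set.mem_ofPred_eq] at hω ⊢
  refine hω.trans_lt ?_
  obtain ⟨z, hzC, hz⟩ := hμ.exists_ne_zero
  have hL : 0 < SketchedPGD.lipschitzConst A := by
    have hzn : 0 < ‖z‖ ^ 2 := by positivity
    exact hμ.1.1.trans_le (le_of_mul_le_mul_right
      ((hμ.1.2 z hzC).trans (SketchedPGD.norm_sq_le_lipschitzConst A z)) hzn)
  have hβ : 0 < SketchedPGD.gaussianNormMean m -
      SketchedPGD.coneWidth A (SketchedPGD.descentCone K x) - θ := by linarith
  have hμ0 := hμ.1.1
  have : 0 < μ / SketchedPGD.lipschitzConst A *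
      ((SketchedPGD.gaussianNormMean m
        - SketchedPGD.coneWidth A (SketchedPGD.descentCone K x) - θ) ^ 2 /
        (SketchedPGD.gaussianNormMean m + √(d : ℝ) + θ) ^ 2) := by
    have : 0 < SketchedPGD.gaussianNormMean m + √(d : ℝ) + θ := by positivity
    positivity
  linarith
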